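/- Time is divided into slots $0,1,2,\dots$. In slot $j$ a user issues $\delta_j$ jobs, where $\delta_0,\delta_1,\dots$ are i.i.d. Bernoulli($\lambda$), $0\le\lambda<1$, and an attacker issues at most one job; $A_1<A_2<\cdots$ are the slots in which the attacker's jobs are issued. All jobs enter one first-come-first-serve (FCFS) queue, which is empty at time $0$ and serves one job per slot whenever it is not empty; if both parties issue a job in the same slot, the attacker's job enters first. Thus, if $q(t)$ is the queue length at the beginning of slot $t$, the attacker's $i$-th job departs at time $D_i=A_i+q(A_i)+1$. The attacker chooses the times $A_i$ causally: whether he issues a job in slot $t$ depends only on private randomness that is independent of the user, and on the arrival and departure times of those of his jobs that have departed by time $t$. For a clock period $T\in\mathbb N$ let $X_k=\sum_{j=(k-1)T}^{kT-1}\delta_j$, $k\ge 1$, be the user's job counts. The privacy of the user is $$\mathcal P^T=\inf_{\mathbf A:\ \omega<1-\lambda}\ \lim_{n\to\infty}\frac{H\left(X_1,\dots,X_n\mid A_1,\dots,A_m,D_1,\dots,D_m\right)}{n},\qquad m=\sup\{k: A_k\le nT\},$$ where $H$ is the Shannon conditional entropy, and the infimum is over all attacks for which the limit exists and whose long-term rate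 $\omega=\lim_{k\to\infty}k/A_k$ exists almost surely as a constant smaller than $1-\lambda$. **Theorem.** If $T\ge\left\lceil\frac{1}{1-\lambda}\right\rceil$, then the FCFS scheduler provides no privacy: $\mathcal P^T=0$ (in particular, the set of attacks over which the infimum is taken is not empty). The infimum is $0$ already over the non-adaptive attacks, those whose times $A_i$ are chosen in advance from the private randomness alone. -/

import Mathlib

open MeasureTheory ProbabilityTheory Filter Topology

noncomputable section

namespace FCFS

/-! ### The two-user first-come-first-serve scheduler, sample path by sample path

Slots are numbered `0, 1, 2, …`.  `d t` says whether the user issues a job in slot `t`.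
The attacker's jobs are numbered from `0`, and `a k` is the slot in which job `k` is issued;
`a` is strictly increasing, since at most one attacker job is issued per slot. -/

open Classical in
/-- Number (`0` or `1`) of jobs issued by the attacker in slot `t`. -/
def attackerJobs (a : ℕ → ℕ) (t : ℕ) : ℕ := if ∃ k, a k = t then 1 else 0

/-- Queue length at the beginning of slot `t`, before the arrivals of slot `t`.  In every slot
the jobs issued in the slot join the queue and, if the queue is then nonempty, exactly one job is
served: `q (t + 1) = (q t + arrivals - 1)₊`.  (The subtraction of natural numbers truncates.) -/
def queue (a : ℕ → ℕ) (d : ℕ → Bool) : ℕ → ℕ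
  | 0 => 0
  | t + 1 => queue a d t + attackerJobs a t + (d t).toNat - 1

/-- Departure time of the attacker's job `k`: it waits for the jobs that are queued when it
arrives (a user's job of the same slot joins the queue behind it), then takes one slot. -/
def departure (a : ℕ → ℕ) (d : ℕ → Bool) (k : ℕ) : ℕ := a k + queue a d (a k) + 1

/-- Number of user's jobs in the clock period `[kT, (k + 1)T)`, `k = 0, 1, …`. -/
def jobPattern (T : ℕ) (d : ℕ → Bool) (k : ℕ) : ℕ :=
  ∑ j ∈ Finset.Ico (k * T) ((k + 1) * T), (d j).toNat

/-- Number `m` of attacker's jobs issued up to time `nT` (inclusive). -/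
def numJobs (T : ℕ) (a : ℕ → ℕ) (n : ℕ) : ℕ := Set.ncard {k | a k ≤ n * T}

/-- The attacker's observations of the first `n` clock periods: arrival times and departure times
of the `m` jobs issued up to time `nT`. -/
def transcript (T : ℕ) (a : ℕ → ℕ) (d : ℕ → Bool) (n : ℕ) : List ℕ × List ℕ :=
  ((List.range (numJobs T a n)).map a, (List.range (numJobs T a n)).map (departure a d))

/-! ### Equivocation -/

/-- Shannon conditional entropy `H(X | Y)`, in bits, of discrete random variables. -/
def condEntropy {Ω α β : Type*} [MeasurableSpace Ω] (P : Measure Ω) (X : Ω → α) (Y : Ω → β) : ℝ :=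
  ∑' y : β, ∑' x : α,
    -(P.real {ω | X ω = x ∧ Y ω = y} *
      Real.logb 2 (P.real {ω | X ω = x ∧ Y ω = y} / P.real {ω | Y ω = y}))

/-- `H(X₁, …, Xₙ | A₁, …, Aₘ, D₁, …, Dₘ)`. -/
def equivocation {Ω : Type*} [MeasurableSpace Ω] (P : Measure Ω) (δ : ℕ → Ω → Bool)
    (A : ℕ → Ω → ℕ) (T n : ℕ) : ℝ :=
  condEntropy P (fun ω (k : Fin n) => jobPattern T (fun j => δ j ω) k)
    (fun ω => transcript T (fun k => A k ω) (fun j => δ j ω) n)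

/-! ### Attacks -/

/-- What the attacker knows at time `t`: his private randomness `U`, and the arrival and departure
times of those of his jobs that have departed by time `t`. -/
@[reducible] def knowledge {Ω : Type*} (U : Ω → ℝ) (δ : ℕ → Ω → Bool) (A : ℕ → Ω → ℕ) (t : ℕ) :
    MeasurableSpace Ω :=
  MeasurableSpace.comap U inferInstance ⊔
    MeasurableSpace.generateFrom {S | ∃ k a d, d ≤ t ∧
      S = {ω | A k ω = a ∧ departure (fun i => A i ω) (fun j => δ j ω) k = d}}

/-- The attacks: whether a job is issued in slot `t` is decided from the private randomness and
the past observations. -/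
structure IsCausalAttack {Ω : Type*} [MeasurableSpace Ω] (U : Ω → ℝ) (δ : ℕ → Ω → Bool)
    (A : ℕ → Ω → ℕ) : Prop where
  strictMono : ∀ ω, StrictMono fun k => A k ω
  measurable : ∀ k, Measurable (A k)
  causal : ∀ k t, MeasurableSet[knowledge U δ A t] {ω | A k ω = t}

/-- The non-adaptive attacks: the (possibly random) issue times are chosen in advance, from the
private randomness alone. -/
structure IsObliviousAttack {Ω : Type*} [MeasurableSpace Ω] (U : Ω → ℝ)
    (A : ℕ → Ω → ℕ) : Prop where
  strictMono : ∀ ω, StrictMono fun k => A k ω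
  measurable : ∀ k, Measurable (A k)
  oblivious : ∀ k, Measurable[MeasurableSpace.comap U inferInstance] (A k)

/-- The attacker's long-term job rate is `w`: almost surely `k / A_k → w`, where `A_k` is the
issue time of the `k`-th job, which is job `k - 1` in the present numbering. -/
def HasRate {Ω : Type*} [MeasurableSpace Ω] (P : Measure Ω) (A : ℕ → Ω → ℕ) (w : ℝ) : Prop :=
  ∀ᵐ ω ∂P, Tendsto (fun k : ℕ => ((k : ℝ) + 1) / (A k ω : ℝ)) atTop (𝓝 w)

/-- The limiting equivocation rates `limₙ H(Xⁿ | Aᵐ, Dᵐ) / n` of the attacks in the class `C`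
that have a long-term rate smaller than `1 - lam`.  The infimum of this set is the privacy of the
user against the attacks in `C`. -/
def equivocationRates {Ω : Type*} [MeasurableSpace Ω] (P : Measure Ω) (δ : ℕ → Ω → Bool)
    (lam : ℝ) (T : ℕ) (C : Set (ℕ → Ω → ℕ)) : Set ℝ :=
  {L | ∃ A ∈ C, (∃ w : ℝ, w < 1 - lam ∧ HasRate P A w) ∧
    Tendsto (fun n : ℕ => equivocation P δ A T n / (n : ℝ)) atTop (𝓝 L)}

end FCFS

end

/-! A busy server completes exactly one job per slot. So if it never idles between two instants at
which the queue length is known, the number of user's jobs issued between them is known as well.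
When the issue times are fixed in advance, a departure time amounts to the queue length at the issue
time. The attacker thus wants one sample at the start of each period and a queue that rarely
empties.

One sample per period loads the server by `1 / T`, and `1 ≤ (1 - lam) * T` says that this load fits
beside the user's. A backlog then drains at mean speed `(1 - lam) * T - 1 ≥ 0` per period. The
schedule repeats three phases: a burst with a job in every slot builds a backlog, a long phase of
single samples lives on it, and a short silence brings the long-term rate below `1 - lam`.
Positivity of `surplus` means that in the mean the backlog outlasts the sampling.

The phases keep their proportions while the blocks grow linearly. By Hoeffding's inequality the
backlog then runs out early with vanishing probability (`measureReal_residue_le`), and `n` periods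
meet only `O(√n)` blocks. Hence only the silent counts remain unknown, up to `o(n)`
(`equivocation_le`). Since an attack qualifies only if its equivocation rate converges, a matching
lower bound is needed too (`le_equivocation`): about the silent counts the transcript reveals no
more than the `O(√n)` queue lengths at the ends of the silences do. The rate is therefore exactly `s
/ len` times the entropy of one count, and `exists_blockPlan` makes this share as small as desired.
For `lam = 0` no surplus is possible, but there is nothing to learn. -/

/-! ### Entropy of functions on a finite weighted space -/

namespace FiniteEntropy

variable {S α β γ : Type*} [Fintype S] {p : S → ℝ}

open Classical in
/-- The total weight of the fibre of `f` over `y`. -/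
noncomputable def mass (p : S → ℝ) (f : S → α) (y : α) : ℝ := ∑ s with f s = y, p s

/-- The Shannon entropy, in nats, of `f` under the weights `p`. -/
noncomputable def ent (p : S → ℝ) (f : S → α) : ℝ := -∑ s, p s * Real.log (mass p f (f s))

lemma mass_nonneg (hp : ∀ s, 0 ≤ p s) (f : S → α) (y : α) : 0 ≤ mass p f y :=
  Finset.sum_nonneg fun s _ => hp s

lemma mass_mono (hp : ∀ s, 0 ≤ p s) {f : S → α} {g : S → β} {x : α} {y : β}
    (h : ∀ s, f s = x → g s = y) : mass p f x ≤ mass p g y := by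
  classical
  unfold mass
  refine Finset.sum_le_sum_of_subset_of_nonneg ?_ fun s _ _ => hp s
  intro s hs
  simp only [Finset.mem_filter, Finset.mem_univ, true_and] at hs ⊢
  exact h s hs

lemma le_mass (hp : ∀ s, 0 ≤ p s) (f : S → α) (s : S) : p s ≤ mass p f (f s) := by
  classical
  unfold mass
  exact Finset.single_le_sum (f := p) (fun i _ => hp i) (by simp)

lemma mass_pos (hp : ∀ s, 0 ≤ p s) (f : S → α) {s : S} (hs : 0 < p s) :
    0 < mass p f (f s) := hs.trans_le (le_mass hp f s)

/-- The fibres of `g` refine those of `f`, so the masses compare pointwise. -/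
lemma ent_le_of_determines (hp : ∀ s, 0 ≤ p s) {f : S → α} {g : S → β}
    (h : ∀ s s', g s = g s' → f s = f s') : ent p f ≤ ent p g := by
  unfold ent
  refine neg_le_neg (Finset.sum_le_sum fun s _ => ?_)
  rcases (hp s).eq_or_lt with h0 | h0
  · simp [← h0]
  · refine mul_le_mul_of_nonneg_left (Real.log_le_log (mass_pos hp g h0) ?_) (hp s)
    exact mass_mono hp fun s' hs' => h _ _ hs'

lemma ent_congr (hp : ∀ s, 0 ≤ p s) {f : S → α} {g : S → β}
    (h : ∀ s s', g s = g s' ↔ f s = f s') : ent p f = ent p g :=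
  le_antisymm (ent_le_of_determines hp fun s s' => (h s s').1)
    (ent_le_of_determines hp fun s s' => (h s s').2)

lemma sum_mul_comp (f : S → α) {Y : Finset α} (hY : ∀ s, f s ∈ Y) (φ : α → ℝ) :
    ∑ s, p s * φ (f s) = ∑ y ∈ Y, mass p f y * φ y := by
  classical
  rw [← Finset.sum_fiberwise_of_maps_to (s := Finset.univ) (t := Y) (g := f) (fun s _ => hY s)]
  refine Finset.sum_congr rfl fun y _ => ?_
  unfold mass
  rw [Finset.sum_mul]
  refine Finset.sum_congr (by ext; simp) fun s hs => ?_
  rw [(Finset.mem_filter.1 hs).2]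

/-- A value of positive mass contributes exactly `φ y`, any other value 0. Combined with `log x ≤ x
- 1` this is Gibbs' inequality; it drives both submodularity and the bound by the logarithm of the
cardinality. -/
lemma sum_mul_div_mass_le (hp : ∀ s, 0 ≤ p s) (f : S → α) {Y : Finset α} (hY : ∀ s, f s ∈ Y)
    {φ : α → ℝ} (hφ : ∀ y, 0 ≤ φ y) :
    ∑ s, p s * (φ (f s) / mass p f (f s)) ≤ ∑ y ∈ Y, φ y := by
  rw [sum_mul_comp f hY fun y => φ y / mass p f y]
  refine Finset.sum_le_sum fun y _ => ?_
  rcases (mass_nonneg hp f y).eq_or_lt with h0 | h0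
  · simpa [← h0] using hφ y
  · rw [mul_div_cancel₀ _ h0.ne']

lemma sum_mass (f : S → α) {Y : Finset α} (hY : ∀ s, f s ∈ Y) :
    ∑ y ∈ Y, mass p f y = ∑ s, p s := by
  have := sum_mul_comp (p := p) f hY fun _ => 1
  simpa using this.symm

lemma sum_mass_prod_left (f : S → α) (h : S → β) {X : Finset α} (hX : ∀ s, f s ∈ X) (z : β) :
    ∑ x ∈ X, mass p (fun s => (f s, h s)) (x, z) = mass p h z := by
  classical
  unfold mass
  rw [← Finset.sum_fiberwise_of_maps_to (s := Finset.univ.filter fun s => h s = z) (t := X)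
    (g := f) (fun s _ => hX s)]
  refine Finset.sum_congr rfl fun x _ => Finset.sum_congr ?_ fun _ _ => rfl
  ext s
  simp [and_comm]

lemma ent_eq_sum (f : S → α) {Y : Finset α} (hY : ∀ s, f s ∈ Y) :
    ent p f = ∑ y ∈ Y, Real.negMulLog (mass p f y) := by
  unfold ent
  rw [sum_mul_comp f hY fun y => Real.log (mass p f y), ← Finset.sum_neg_distrib]
  simp [Real.negMulLog]

lemma ent_const (hp1 : ∑ s, p s = 1) (c : α) : ent p (fun _ => c) = 0 := by
  simp [ent, mass, hp1]

/-- Submodularity of entropy. -/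
lemma ent_submodular (hp : ∀ s, 0 ≤ p s) (f : S → α) (g : S → β) (h : S → γ) :
    ent p (fun s => (f s, g s, h s)) + ent p h ≤
      ent p (fun s => (f s, h s)) + ent p (fun s => (g s, h s)) := by
  classical
  set F : S → α × γ := fun s => (f s, h s) with hF
  set G : S → β × γ := fun s => (g s, h s) with hG
  set K : S → α × β × γ := fun s => (f s, g s, h s) with hK
  -- The law with the same pair marginals under which `f` and `g` are conditionally independent
  -- given `h`. The lemma is nonnegativity of the divergence of the joint law from it.
  let φ : α × β × γ → ℝ := fun y =>
    mass p F (y.1, y.2.2) * mass p G (y.2.1, y.2.2) / mass p h y.2.2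
  have hφ : ∀ y, 0 ≤ φ y := fun y =>
    div_nonneg (mul_nonneg (mass_nonneg hp _ _) (mass_nonneg hp _ _)) (mass_nonneg hp _ _)
  have key : ∑ s, p s * (φ (K s) / mass p K (K s)) ≤ ∑ s, p s := by
    refine (sum_mul_div_mass_le hp K (Y := Finset.univ.image f ×ˢ
      (Finset.univ.image g ×ˢ Finset.univ.image h)) (by intro s; simp [hK]) hφ).trans ?_
    rw [Finset.sum_product]
    simp_rw [Finset.sum_product_right]
    rw [Finset.sum_comm, ← sum_mass (p := p) h (Y := Finset.univ.image h) (by simp)]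
    refine Finset.sum_le_sum fun z _ => ?_
    have : ∑ x ∈ Finset.univ.image f, ∑ y ∈ Finset.univ.image g, φ (x, y, z)
        = mass p h z * mass p h z / mass p h z := by
      simp only [φ]
      simp_rw [← Finset.sum_div, ← Finset.mul_sum, ← Finset.sum_mul]
      rw [sum_mass_prod_left f h (by simp), sum_mass_prod_left g h (by simp)]
    rw [this]
    exact (mul_self_div_self _).le
  have term : ∀ s, p s * (Real.log (mass p F (F s)) + Real.log (mass p G (G s))
      - Real.log (mass p K (K s)) - Real.log (mass p h (h s)))
      ≤ p s * (φ (K s) / mass p K (K s)) - p s := by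
    intro s
    rcases (hp s).eq_or_lt with h0 | h0
    · simp [← h0]
    have h1 := mass_pos hp F h0
    have h2 := mass_pos hp G h0
    have h3 := mass_pos hp K h0
    have h4 := mass_pos hp h h0
    have e : φ (K s) / mass p K (K s)
        = mass p F (F s) * mass p G (G s) / (mass p h (h s) * mass p K (K s)) := by
      simp only [φ, hK, hF, hG]
      rw [div_div]
    have := Real.log_le_sub_one_of_pos (x := φ (K s) / mass p K (K s)) (by rw [e]; positivity)
    rw [e, Real.log_div (by positivity) (by positivity), Real.log_mul h1.ne' h2.ne',
      Real.log_mul h4.ne' h3.ne', ← e] at this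
    nlinarith
  have total := Finset.sum_le_sum fun s (_ : s ∈ Finset.univ) => term s
  simp only [mul_sub, mul_add, Finset.sum_sub_distrib, Finset.sum_add_distrib] at total
  unfold ent
  linarith

lemma ent_prod_le (hp : ∀ s, 0 ≤ p s) (hp1 : ∑ s, p s = 1) (f : S → α) (g : S → β) :
    ent p (fun s => (f s, g s)) ≤ ent p f + ent p g := by
  have := ent_submodular hp f g fun _ => ()
  rw [ent_const hp1, add_zero] at this
  rwa [ent_congr hp (f := fun s => (f s, g s, ())) (g := fun s => (f s, g s)) (by simp),
    ent_congr hp (f := fun s => (f s, ())) (g := f) (by simp),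
    ent_congr hp (f := fun s => (g s, ())) (g := g) (by simp)] at this

lemma ent_pi_le {ι : Type*} (hp : ∀ s, 0 ≤ p s) (hp1 : ∑ s, p s = 1) (f : ι → S → α)
    (I : Finset ι) : ent p (fun s (i : I) => f i s) ≤ ∑ i ∈ I, ent p (f i) := by
  classical
  induction I using Finset.induction_on with
  | empty =>
    rw [ent_congr hp (g := fun _ => ()) (by simp [funext_iff]), ent_const hp1]; simp
  | insert a I ha ih =>
    rw [Finset.sum_insert ha]
    refine le_trans ?_ ((ent_prod_le hp hp1 (f a) fun s (i : I) => f i s).trans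
      (by gcongr))
    refine ent_le_of_determines hp fun s s' h => ?_
    simp only [Prod.mk.injEq, funext_iff, Subtype.forall] at h ⊢
    intro i hi
    rcases Finset.mem_insert.1 hi with rfl | hi
    · exact h.1
    · exact h.2 i hi

lemma ent_le_log_card (hp : ∀ s, 0 ≤ p s) (hp1 : ∑ s, p s = 1) (f : S → α) {Y : Finset α}
    (hY : ∀ s, f s ∈ Y) : ent p f ≤ Real.log Y.card := by
  have hne : Nonempty S := by
    by_contra h
    rw [not_nonempty_iff] at h
    simp at hp1
  have hc : (0 : ℝ) < Y.card := by
    exact_mod_cast Finset.card_pos.2 ⟨_, hY hne.some⟩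
  have key := sum_mul_div_mass_le hp f hY (φ := fun _ => 1 / (Y.card : ℝ)) fun _ => by positivity
  rw [Finset.sum_const, nsmul_eq_mul, mul_one_div_cancel hc.ne'] at key
  have term : ∀ s, -(p s * Real.log (mass p f (f s))) - p s * Real.log Y.card
      ≤ p s * (1 / (Y.card : ℝ) / mass p f (f s)) - p s := by
    intro s
    rcases (hp s).eq_or_lt with h0 | h0
    · simp [← h0]
    have h1 := mass_pos hp f h0
    have := Real.log_le_sub_one_of_pos (x := 1 / (Y.card : ℝ) / mass p f (f s)) (by positivity)
    rw [Real.log_div (by positivity) h1.ne', Real.log_div one_ne_zero hc.ne', Real.log_one] at this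
    nlinarith
  have total := Finset.sum_le_sum fun s (_ : s ∈ Finset.univ) => term s
  simp only [Finset.sum_sub_distrib, Finset.sum_neg_distrib, ← Finset.sum_mul, hp1] at total
  unfold ent
  linarith

lemma ent_prod_eq (hp : ∀ s, 0 ≤ p s) (f : S → α) (g : S → β)
    (h : ∀ x y, mass p (fun s => (f s, g s)) (x, y) = mass p f x * mass p g y) :
    ent p (fun s => (f s, g s)) = ent p f + ent p g := by
  unfold ent
  rw [← neg_add, ← Finset.sum_add_distrib]
  refine congrArg Neg.neg (Finset.sum_congr rfl fun s _ => ?_)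
  rcases (hp s).eq_or_lt with h0 | h0
  · simp [← h0]
  rw [h, Real.log_mul (mass_pos hp f h0).ne' (mass_pos hp g h0).ne', mul_add]

lemma mass_eq_measureReal {Ω : Type*} [MeasurableSpace Ω] {P : Measure Ω} [IsProbabilityMeasure P]
    {W : Ω → S} (hW : ∀ s, MeasurableSet (W ⁻¹' {s})) (f : S → α) (y : α) :
    mass (fun s => P.real (W ⁻¹' {s})) f y = P.real {ω | f (W ω) = y} := by
  classical
  unfold mass
  rw [sum_measureReal_preimage_singleton _ (fun s _ => hW s)]
  congr 1
  ext ω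
  simp

/-- The chain rule. Values that are not attained contribute 0, so the infinite sums collapse to
finite ones. -/
lemma condEntropy_eq {Ω : Type*} [MeasurableSpace Ω] {P : Measure Ω} [IsProbabilityMeasure P]
    {W : Ω → S} (hW : ∀ s, MeasurableSet (W ⁻¹' {s})) (f : S → α) (g : S → β) :
    FCFS.condEntropy P (fun ω => f (W ω)) (fun ω => g (W ω)) =
      (ent (fun s => P.real (W ⁻¹' {s})) (fun s => (f s, g s))
        - ent (fun s => P.real (W ⁻¹' {s})) g) / Real.log 2 := by
  classical
  set p : S → ℝ := fun s => P.real (W ⁻¹' {s}) with hpdef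
  have hp : ∀ s, 0 ≤ p s := fun s => measureReal_nonneg
  have h1 : ∀ x y, P.real {ω | f (W ω) = x ∧ g (W ω) = y} = mass p (fun s => (f s, g s)) (x, y) := by
    intro x y
    rw [mass_eq_measureReal hW]
    simp
  have h2 : ∀ y, P.real {ω | g (W ω) = y} = mass p g y := fun y => (mass_eq_measureReal hW g y).symm
  have hzero : ∀ x y, (¬ ∃ s, f s = x ∧ g s = y) → mass p (fun s => (f s, g s)) (x, y) = 0 := by
    intro x y h
    unfold mass
    refine Finset.sum_eq_zero fun s hs => absurd ⟨s, ?_⟩ h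
    simpa using hs
  unfold FCFS.condEntropy
  simp_rw [h1, h2]
  have hin : ∀ y, (∑' x : α, -(mass p (fun s => (f s, g s)) (x, y) *
      Real.logb 2 (mass p (fun s => (f s, g s)) (x, y) / mass p g y)))
      = ∑ x ∈ Finset.univ.image f, -(mass p (fun s => (f s, g s)) (x, y) *
      Real.logb 2 (mass p (fun s => (f s, g s)) (x, y) / mass p g y)) := by
    intro y
    refine tsum_eq_sum fun x hx => ?_
    rw [hzero x y (by rintro ⟨s, rfl, -⟩; simp at hx)]
    simp
  simp_rw [hin]
  rw [tsum_eq_sum (s := Finset.univ.image g), ← Finset.sum_product_right']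
  · have := sum_mul_comp (p := p) (fun s => (f s, g s))
      (Y := Finset.univ.image f ×ˢ Finset.univ.image g) (by simp)
      (fun y => Real.logb 2 (mass p (fun s => (f s, g s)) y / mass p g y.2))
    simp only [Finset.sum_neg_distrib]
    rw [← this]
    unfold ent
    rw [neg_sub_neg, ← Finset.sum_sub_distrib, Finset.sum_div, ← Finset.sum_neg_distrib]
    refine Finset.sum_congr rfl fun s _ => ?_
    rcases (hp s).eq_or_lt with h0 | h0
    · simp [← h0]
    have a1 := mass_pos hp (fun s => (f s, g s)) h0
    have a2 := mass_pos hp g h0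
    rw [Real.logb, Real.log_div a1.ne' a2.ne']
    ring
  · intro y hy
    refine Finset.sum_eq_zero fun x _ => ?_
    rw [hzero x y (by rintro ⟨s, -, rfl⟩; simp at hy)]
    simp

end FiniteEntropy

/-! ### The queue, sample path by sample path -/

namespace FCFS

lemma attackerJobs_le_one (a : ℕ → ℕ) (t : ℕ) : attackerJobs a t ≤ 1 := by
  unfold attackerJobs; split <;> simp

lemma queue_le (a : ℕ → ℕ) (d : ℕ → Bool) (t : ℕ) : queue a d t ≤ t := by
  induction t with
  | zero => simp [queue]
  | succ t ih =>
    have h1 := attackerJobs_le_one a t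
    have h2 := Bool.toNat_le (d t)
    simp only [queue]
    omega

lemma queue_congr (a : ℕ → ℕ) {d d' : ℕ → Bool} {t : ℕ} (h : ∀ j < t, d j = d' j) :
    queue a d t = queue a d' t := by
  induction t with
  | zero => rfl
  | succ t ih =>
    simp only [queue]
    rw [ih fun j hj => h j (by omega), h t (by omega)]

/-- At most one job leaves per slot; an idle slot only makes the inequality strict. -/
lemma queue_add_sub_ge (a : ℕ → ℕ) (d : ℕ → Bool) {t₁ t₂ : ℕ} (h : t₁ ≤ t₂) :
    queue a d t₁ + ∑ t ∈ Finset.Ico t₁ t₂, (attackerJobs a t + (d t).toNat)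
      ≤ queue a d t₂ + (t₂ - t₁) := by
  induction t₂, h using Nat.le_induction with
  | base => simp
  | succ t ht ih =>
    rw [Finset.sum_Ico_succ_top ht]
    simp only [queue]
    omega

lemma queue_add_sub_eq (a : ℕ → ℕ) (d : ℕ → Bool) {t₁ t₂ : ℕ} (h : t₁ ≤ t₂)
    (hbusy : ∀ t ∈ Finset.Ico t₁ t₂, 1 ≤ queue a d t + attackerJobs a t) :
    queue a d t₁ + ∑ t ∈ Finset.Ico t₁ t₂, (attackerJobs a t + (d t).toNat)
      = queue a d t₂ + (t₂ - t₁) := by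
  induction t₂, h using Nat.le_induction with
  | base => simp
  | succ t ht ih =>
    have h1 := ih fun u hu => hbusy u (by simp only [Finset.mem_Ico] at hu ⊢; omega)
    have h2 := hbusy t (by simp only [Finset.mem_Ico]; omega)
    rw [Finset.sum_Ico_succ_top ht]
    simp only [queue]
    omega

/-- A backlog at least as long as the interval cannot be exhausted before its last slot, so no slot
is idle. -/
lemma queue_add_sub_eq_of_le (a : ℕ → ℕ) (d : ℕ → Bool) {t₁ t₂ : ℕ} (h : t₁ ≤ t₂)
    (hlong : t₂ - t₁ ≤ queue a d t₁) :
    queue a d t₁ + ∑ t ∈ Finset.Ico t₁ t₂, (attackerJobs a t + (d t).toNat)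
      = queue a d t₂ + (t₂ - t₁) := by
  refine queue_add_sub_eq a d h fun t ht => ?_
  rw [Finset.mem_Ico] at ht
  have := queue_add_sub_ge a d ht.1
  omega

variable {J : ℕ → Prop}

open Classical in
lemma attackerJobs_nth (hJ : {t | J t}.Infinite) (t : ℕ) :
    attackerJobs (Nat.nth J) t = if J t then 1 else 0 := by
  unfold attackerJobs
  have : (∃ k, Nat.nth J k = t) ↔ J t := by
    have := Nat.range_nth_of_infinite hJ
    rw [Set.ext_iff] at this
    exact this t
  simp only [this]

lemma nth_le_iff_lt_numJobs (hJ : {t | J t}.Infinite) (T n k : ℕ) :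
    Nat.nth J k ≤ n * T ↔ k < numJobs T (Nat.nth J) n := by
  classical
  -- The bound `n * T` is inclusive, hence the `+ 1`. The job issued in slot `n * T`, if there is
  -- one, gives the queue length at the end of the last period.
  have h : ∀ k, Nat.nth J k ≤ n * T ↔ k < Nat.count J (n * T + 1) := by
    intro k
    rw [← not_iff_not, not_le, not_lt, Nat.count_le_iff_le_nth hJ]
    exact Iff.rfl
  have : {k | Nat.nth J k ≤ n * T} = Set.Iio (Nat.count J (n * T + 1)) := by
    ext k; simp [h k]
  rw [h, numJobs, this]
  simp

/-- The transcripts of an attack with deterministic issue times record the queue lengths at these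
times, and nothing else. -/
lemma transcript_eq_iff (hJ : {t | J t}.Infinite) (T n : ℕ) (d d' : ℕ → Bool) :
    transcript T (Nat.nth J) d n = transcript T (Nat.nth J) d' n ↔
      ∀ t ≤ n * T, J t → queue (Nat.nth J) d t = queue (Nat.nth J) d' t := by
  classical
  simp only [transcript, Prod.mk.injEq, true_and, List.map_inj_left, List.mem_range]
  constructor
  · intro h t ht htJ
    have e := Nat.nth_count htJ
    have := h (Nat.count J t) ((nth_le_iff_lt_numJobs hJ T n _).1 (by rwa [e]))
    simp only [departure, e] at this
    omega
  · intro h k hk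
    simp only [departure]
    rw [h _ ((nth_le_iff_lt_numJobs hJ T n k).2 hk) (Nat.nth_mem_of_infinite hJ k)]

lemma transcript_congr (hJ : {t | J t}.Infinite) (T n : ℕ) {d d' : ℕ → Bool}
    (h : ∀ j < n * T, d j = d' j) :
    transcript T (Nat.nth J) d n = transcript T (Nat.nth J) d' n :=
  (transcript_eq_iff hJ T n d d').2 fun _ ht _ => queue_congr _ fun j hj => h j (by omega)

lemma jobPattern_congr {T k : ℕ} {d d' : ℕ → Bool}
    (h : ∀ j, k * T ≤ j → j < (k + 1) * T → d j = d' j) :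
    jobPattern T d k = jobPattern T d' k := by
  refine Finset.sum_congr rfl fun j hj => ?_
  rw [Finset.mem_Ico] at hj
  rw [h j hj.1 hj.2]

lemma jobPattern_le (T : ℕ) (d : ℕ → Bool) (k : ℕ) : jobPattern T d k ≤ T := by
  unfold jobPattern
  refine (Finset.sum_le_card_nsmul _ _ 1 fun j _ => Bool.toNat_le (d j)).trans ?_
  simp [add_mul]

/-- Knowing the user's jobs outside the periods in `S` and the queue lengths at the ends of the
runs of periods in `S`, one knows the queue lengths at all times not strictly inside such a run. -/
lemma queue_eq_of_eq_outside (a : ℕ → ℕ) {T : ℕ} (hT : 0 < T) (S : ℕ → Prop) {n : ℕ}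
    {d d' : ℕ → Bool} (hd : ∀ t < n * T, ¬ S (t / T) → d t = d' t)
    (hend : ∀ k < n, S k → ¬ S (k + 1) →
      queue a d ((k + 1) * T) = queue a d' ((k + 1) * T))
    {t : ℕ} (ht : t ≤ n * T)
    (hvis : ¬ S (t / T) ∨ T ∣ t ∧ (t = 0 ∨ ¬ S (t / T - 1))) :
    queue a d t = queue a d' t := by
  induction t with
  | zero => rfl
  | succ t ih =>
    have key : (t + 1) / T = t / T ∧ ¬ T ∣ t + 1 ∨
        (t + 1) / T = t / T + 1 ∧ t + 1 = (t / T + 1) * T := by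
      by_cases hdvd : T ∣ t + 1
      · right
        rw [Nat.succ_div_of_dvd hdvd]
        refine ⟨rfl, ?_⟩
        rw [← Nat.succ_div_of_dvd hdvd, Nat.div_mul_cancel hdvd]
      · left
        exact ⟨Nat.succ_div_of_not_dvd hdvd, hdvd⟩
    by_cases hS : S (t / T)
    · rcases key with ⟨h1, h2⟩ | ⟨h1, h2⟩
      · rw [h1] at hvis
        tauto
      · rw [h1] at hvis
        rcases hvis with h | ⟨-, h | h⟩
        -- The run of `S` ends here: the recursion cannot be followed through the run, and `hend`
        -- restarts it.
        · rw [h2]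
          exact hend _ (by nlinarith) hS h
        · omega
        · exact absurd hS (by simpa using h)
    · simp only [queue]
      rw [ih (by omega) (Or.inl hS), hd t (by omega) hS]

end FCFS

/-! ### A schedule of issue times made of growing blocks -/

/-- A quantity that grows along the quadratic times `L j ^ 2` like `A j ^ 2 + B j` grows linearly
at rate `A / L`. -/
lemma tendsto_div_of_quadratic_times {g : ℕ → ℕ} (hg : Monotone g) {L A B : ℕ} (hL : 0 < L)
    (h : ∀ j, g (L * j ^ 2) = A * j ^ 2 + B * j) :
    Tendsto (fun n : ℕ => (g n : ℝ) / n) atTop (𝓝 ((A : ℝ) / L)) := by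
  -- This is the index `j` of the last quadratic time up to `n`. Monotonicity squeezes `g n` between
  -- its values at the times `j` and `j + 1`, whose ratio tends to 1.
  have hj : Tendsto (fun n : ℕ => Nat.sqrt (n / L)) atTop atTop := by
    refine tendsto_atTop_atTop.2 fun m => ⟨L * m ^ 2, fun n hn => ?_⟩
    rw [Nat.le_sqrt', Nat.le_div_iff_mul_le hL]
    linarith [mul_comm L (m ^ 2)]
  have hLr : (0 : ℝ) < L := by exact_mod_cast hL
  have h0 : Tendsto (fun j : ℕ => 1 / (j : ℝ)) atTop (𝓝 0) := tendsto_one_div_atTop_nhds_zero_nat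
  have h0' : Tendsto (fun j : ℕ => 1 / ((j : ℝ) + 1)) atTop (𝓝 0) :=
    tendsto_one_div_add_atTop_nhds_zero_nat
  have h1 : Tendsto (fun j : ℕ => 1 - 1 / ((j : ℝ) + 1)) atTop (𝓝 1) := by
    simpa using h0'.const_sub 1
  have h2 : Tendsto (fun j : ℕ => 1 + 1 / (j : ℝ)) atTop (𝓝 1) := by
    simpa using h0.const_add 1
  have lo : Tendsto (fun j : ℕ => ((A : ℝ) * j ^ 2 + B * j) / (L * ((j : ℝ) + 1) ^ 2)) atTop
      (𝓝 ((A : ℝ) / L)) := by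
    have := (((h1.pow 2).const_mul (A : ℝ)).add ((h1.mul h0').const_mul (B : ℝ))).div_const (L : ℝ)
    simp only [one_pow, mul_one, mul_zero, add_zero] at this
    refine this.congr fun j => ?_
    have : (j : ℝ) + 1 ≠ 0 := by positivity
    field_simp
    ring
  have hi : Tendsto (fun j : ℕ => ((A : ℝ) * ((j : ℝ) + 1) ^ 2 + B * ((j : ℝ) + 1)) /
      (L * (j : ℝ) ^ 2)) atTop (𝓝 ((A : ℝ) / L)) := by
    have := (((h2.pow 2).const_mul (A : ℝ)).add ((h2.mul h0).const_mul (B : ℝ))).div_const (L : ℝ)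
    simp only [one_pow, mul_one, mul_zero, add_zero] at this
    refine this.congr' ?_
    filter_upwards [eventually_gt_atTop 0] with j hj
    have : (j : ℝ) ≠ 0 := by positivity
    field_simp
  refine tendsto_of_tendsto_of_tendsto_of_le_of_le' (lo.comp hj) (hi.comp hj) ?_ ?_
  all_goals
    filter_upwards [hj.eventually_gt_atTop 0, eventually_gt_atTop 0] with n hjn hn
    simp only [Function.comp]
    set j := Nat.sqrt (n / L) with hjdef
    have b1 : L * j ^ 2 ≤ n := by
      have := Nat.sqrt_le' (n / L)
      rw [← hjdef, Nat.le_div_iff_mul_le hL] at this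
      linarith [mul_comm L (j ^ 2)]
    have b2 : n ≤ L * (j + 1) ^ 2 := by
      have := Nat.lt_succ_sqrt' (n / L)
      rw [← hjdef, Nat.div_lt_iff_lt_mul hL] at this
      have e : (j.succ) ^ 2 * L = L * (j + 1) ^ 2 := by rw [Nat.succ_eq_add_one, mul_comm]
      omega
    have g1 := hg b1
    have g2 := hg b2
    rw [h] at g1 g2
    have hnr : (0 : ℝ) < n := by exact_mod_cast hn
    have hjr : (0 : ℝ) < j := by exact_mod_cast hjn
    have b1r : (L : ℝ) * j ^ 2 ≤ n := by exact_mod_cast b1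
    have b2r : (n : ℝ) ≤ L * ((j : ℝ) + 1) ^ 2 := by exact_mod_cast b2
    have g1r : (A : ℝ) * j ^ 2 + B * j ≤ g n := by exact_mod_cast g1
    have g2r : (g n : ℝ) ≤ A * ((j : ℝ) + 1) ^ 2 + B * ((j : ℝ) + 1) := by exact_mod_cast g2
    gcongr

namespace FCFS

/-- The parameters of a schedule whose block `j` consists of `(2 j + 1) b` periods with a job in
every slot, `(2 j + 1) c` periods with a job in the first slot, and `(2 j + 1) s` silent periods
(up to one job at the start of the first of them, which samples the queue). -/
structure BlockPlan where
  b : ℕ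
  c : ℕ
  s : ℕ
  T : ℕ
  c_pos : 0 < c
  s_pos : 0 < s
  T_pos : 0 < T

namespace BlockPlan

variable (B : BlockPlan)

/-- The length of block `0`, in periods. -/
def len : ℕ := B.b + B.c + B.s

/-- The number of the block that contains period `k`. -/
def block (k : ℕ) : ℕ := Nat.sqrt (k / B.len)

/-- The ratio of the length of the block of period `k` to that of block `0`. -/
def scale (k : ℕ) : ℕ := 2 * B.block k + 1

/-- The position of period `k` in its block. -/
def offset (k : ℕ) : ℕ := k - B.len * B.block k ^ 2

def IsBurst (k : ℕ) : Prop := B.offset k < B.b * B.scale k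

/-- Because of `≤`, this overlaps `IsSilent` in the first silent period of each block; the sample
there closes the balance of the last period before the silence. -/
def IsSampled (k : ℕ) : Prop := B.offset k ≤ (B.b + B.c) * B.scale k

def IsSilent (k : ℕ) : Prop := (B.b + B.c) * B.scale k ≤ B.offset k

/-- The slots in which a job is issued. -/
def IsJobSlot (t : ℕ) : Prop := B.IsBurst (t / B.T) ∨ B.T ∣ t ∧ B.IsSampled (t / B.T)

instance : DecidablePred B.IsBurst := fun _ => inferInstanceAs (Decidable (_ < _))
instance : DecidablePred B.IsSampled := fun _ => inferInstanceAs (Decidable (_ ≤ _))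
instance : DecidablePred B.IsSilent := fun _ => inferInstanceAs (Decidable (_ ≤ _))
instance : DecidablePred B.IsJobSlot := fun _ => inferInstanceAs (Decidable (_ ∨ _))

lemma len_pos : 0 < B.len := by have := B.c_pos; unfold len; omega

lemma len_mul_block_sq_add_offset (k : ℕ) : B.len * B.block k ^ 2 + B.offset k = k := by
  have h : B.len * B.block k ^ 2 ≤ k := by
    have := Nat.sqrt_le' (k / B.len)
    rw [Nat.le_div_iff_mul_le B.len_pos] at this
    unfold block
    linarith [mul_comm B.len ((k / B.len).sqrt ^ 2)]
  unfold offset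
  omega

lemma offset_lt (k : ℕ) : B.offset k < B.len * B.scale k := by
  have h1 := B.len_mul_block_sq_add_offset k
  have h2 := Nat.lt_succ_sqrt' (k / B.len)
  rw [Nat.div_lt_iff_lt_mul B.len_pos, Nat.succ_eq_add_one] at h2
  have h3 : k < (B.block k + 1) ^ 2 * B.len := h2
  unfold scale
  nlinarith

/-- Since `(j + 1) ^ 2 - j ^ 2 = 2 * j + 1`, block `j` starts at period `len * j ^ 2`. -/
lemma block_offset_of_lt {j i : ℕ} (h : i < B.len * (2 * j + 1)) :
    B.block (B.len * j ^ 2 + i) = j ∧ B.offset (B.len * j ^ 2 + i) = i := by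
  have hb : B.block (B.len * j ^ 2 + i) = j := by
    unfold block
    rw [Nat.mul_add_div B.len_pos]
    refine Nat.sqrt_add_eq' j ?_
    have := (Nat.div_lt_iff_lt_mul B.len_pos (x := i) (y := 2 * j + 1)).2 (by linarith [mul_comm B.len (2 * j + 1)])
    omega
  refine ⟨hb, ?_⟩
  unfold offset
  rw [hb]
  omega

lemma isSampled_of_isBurst {k : ℕ} (h : B.IsBurst k) : B.IsSampled k := by
  unfold IsBurst at h
  unfold IsSampled
  nlinarith

lemma isSampled_of_not_isSilent {k : ℕ} (h : ¬ B.IsSilent k) : B.IsSampled k := by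
  unfold IsSilent at h
  unfold IsSampled
  omega

lemma block_offset_succ {k : ℕ} (h : ¬ B.IsSilent k) :
    B.block (k + 1) = B.block k ∧ B.offset (k + 1) = B.offset k + 1 := by
  unfold IsSilent at h
  have h1 := B.len_mul_block_sq_add_offset k
  have hs := B.s_pos
  have h2 : B.offset k + 1 < B.len * (2 * B.block k + 1) := by
    have : B.len * B.scale k = (B.b + B.c) * B.scale k + B.s * B.scale k := by unfold len; ring
    have h3 : 0 < B.s * B.scale k := Nat.mul_pos hs (by unfold scale; omega)
    change B.offset k + 1 < B.len * B.scale k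
    omega
  have := B.block_offset_of_lt h2
  rwa [← add_assoc, h1] at this

lemma isSampled_succ {k : ℕ} (h : ¬ B.IsSilent k) : B.IsSampled (k + 1) := by
  obtain ⟨h1, h2⟩ := B.block_offset_succ h
  unfold IsSilent at h
  unfold IsSampled scale
  rw [h1, h2]
  unfold scale at h
  omega

lemma isJobSlot_mul {k : ℕ} (h : B.IsSampled k) : B.IsJobSlot (k * B.T) :=
  Or.inr ⟨Dvd.intro_left k rfl, by rwa [Nat.mul_div_cancel _ B.T_pos]⟩

lemma not_isSilent_of_isBurst {k : ℕ} (h : B.IsBurst k) : ¬ B.IsSilent k := by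
  unfold IsBurst at h
  unfold IsSilent
  nlinarith

/-- The queue is never sampled strictly inside a run of silent periods. -/
lemma visible_of_isJobSlot {t : ℕ} (h : B.IsJobSlot t) :
    ¬ B.IsSilent (t / B.T) ∨ B.T ∣ t ∧ (t = 0 ∨ ¬ B.IsSilent (t / B.T - 1)) := by
  rcases h with h | ⟨h1, h2⟩
  · exact Or.inl (B.not_isSilent_of_isBurst h)
  by_cases hS : B.IsSilent (t / B.T)
  swap
  · exact Or.inl hS
  refine Or.inr ⟨h1, Or.inr ?_⟩
  set k := t / B.T
  have hoff : B.offset k = (B.b + B.c) * B.scale k := le_antisymm h2 hS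
  -- As `c > 0`, the sampled silent period is not the first of its block, so its predecessor lies in
  -- the same block, just before the silence.
  have hpos : 0 < (B.b + B.c) * B.scale k :=
    Nat.mul_pos (by have := B.c_pos; omega) (by unfold scale; omega)
  have h3 := B.len_mul_block_sq_add_offset k
  have h4 := B.offset_lt k
  obtain ⟨h5, h6⟩ := B.block_offset_of_lt (j := B.block k) (i := B.offset k - 1)
    (by change _ < B.len * B.scale k; omega)
  rw [show B.len * B.block k ^ 2 + (B.offset k - 1) = k - 1 by omega] at h5 h6
  unfold IsSilent scale
  rw [h5, h6]
  change ¬ (B.b + B.c) * B.scale k ≤ _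
  omega

/-- The number of jobs issued in period `k`. -/
def jobsIn (k : ℕ) : ℕ := if B.IsBurst k then B.T else if B.IsSampled k then 1 else 0

lemma jobsIn_eq (k : ℕ) : B.jobsIn k =
    (B.T - 1) * (if B.IsBurst k then 1 else 0) + (if B.IsSampled k then 1 else 0) := by
  unfold jobsIn
  have := B.T_pos
  by_cases h : B.IsBurst k
  · simp [h, B.isSampled_of_isBurst h]; omega
  · simp [h]

lemma div_eq_of_mem {k t T : ℕ} (h : t ∈ Finset.Ico (k * T) ((k + 1) * T)) : t / T = k := by
  rw [Finset.mem_Ico] at h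
  exact Nat.div_eq_of_lt_le h.1 h.2

lemma sum_isJobSlot_period (k : ℕ) :
    ∑ t ∈ Finset.Ico (k * B.T) ((k + 1) * B.T), (if B.IsJobSlot t then 1 else 0) = B.jobsIn k := by
  have hT := B.T_pos
  have hle : k * B.T < (k + 1) * B.T := by rw [add_mul]; omega
  unfold jobsIn
  by_cases h : B.IsBurst k
  · rw [if_pos h, Finset.sum_congr rfl (g := fun _ => 1)]
    · simp [add_mul]
    · intro t ht
      exact if_pos (Or.inl (by rwa [div_eq_of_mem ht]))
  · rw [if_neg h, Finset.sum_eq_single_of_mem (k * B.T) (Finset.mem_Ico.2 ⟨le_rfl, hle⟩)]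
    · simp [IsJobSlot, Nat.mul_div_cancel _ hT, h]
    · intro t ht hne
      rw [if_neg]
      rintro (h' | ⟨⟨m, rfl⟩, -⟩)
      · rw [div_eq_of_mem ht] at h'
        exact h h'
      · have := div_eq_of_mem ht
        rw [Nat.mul_div_cancel_left _ hT] at this
        subst this
        exact hne (mul_comm _ _)

lemma sum_isJobSlot_periods {k₁ k₂ : ℕ} (h : k₁ ≤ k₂) :
    ∑ t ∈ Finset.Ico (k₁ * B.T) (k₂ * B.T), (if B.IsJobSlot t then 1 else 0)
      = ∑ k ∈ Finset.Ico k₁ k₂, B.jobsIn k := by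
  induction k₂, h using Nat.le_induction with
  | base => simp
  | succ k hk ih =>
    rw [Finset.sum_Ico_succ_top hk, ← ih, ← B.sum_isJobSlot_period k,
      Finset.sum_Ico_consecutive _ (Nat.mul_le_mul_right _ hk) (Nat.mul_le_mul_right _ (by omega))]

lemma sum_block (φ : ℕ → ℕ) (j : ℕ) :
    ∑ k ∈ Finset.range (B.len * (j + 1) ^ 2), φ k = ∑ k ∈ Finset.range (B.len * j ^ 2), φ k
      + ∑ i ∈ Finset.range (B.len * (2 * j + 1)), φ (B.len * j ^ 2 + i) := by
  rw [show B.len * (j + 1) ^ 2 = B.len * j ^ 2 + B.len * (2 * j + 1) by ring,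
    Finset.sum_range_add]

lemma sum_range_ite_lt {m n : ℕ} (h : m ≤ n) :
    ∑ i ∈ Finset.range n, (if i < m then 1 else 0) = m := by
  rw [Finset.sum_boole, Nat.cast_id]
  convert Finset.card_range m using 2
  ext i
  simp only [Finset.mem_filter, Finset.mem_range]
  omega

lemma sum_isSilent_blocks (j : ℕ) :
    ∑ k ∈ Finset.range (B.len * j ^ 2), (if B.IsSilent k then 1 else 0) = B.s * j ^ 2 := by
  induction j with
  | zero => simp
  | succ j ih =>
    rw [B.sum_block, ih]
    have : ∀ i ∈ Finset.range (B.len * (2 * j + 1)),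
        (if B.IsSilent (B.len * j ^ 2 + i) then 1 else 0)
          = 1 - (if i < (B.b + B.c) * (2 * j + 1) then 1 else 0) := by
      intro i hi
      obtain ⟨h1, h2⟩ := B.block_offset_of_lt (Finset.mem_range.1 hi)
      simp only [IsSilent, scale, h1, h2]
      split_ifs <;> omega
    rw [Finset.sum_congr rfl this]
    have hle : (B.b + B.c) * (2 * j + 1) ≤ B.len * (2 * j + 1) :=
      Nat.mul_le_mul_right _ (by unfold len; omega)
    have e := sum_range_ite_lt hle
    have e2 : ∑ i ∈ Finset.range (B.len * (2 * j + 1)),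
        (1 - (if i < (B.b + B.c) * (2 * j + 1) then 1 else 0))
        + ∑ i ∈ Finset.range (B.len * (2 * j + 1)),
          (if i < (B.b + B.c) * (2 * j + 1) then 1 else 0) = B.len * (2 * j + 1) := by
      rw [← Finset.sum_add_distrib, Finset.sum_congr rfl (g := fun _ => 1)]
      · simp
      · intro i _; split_ifs <;> rfl
    rw [e] at e2
    unfold len at e2 ⊢
    nlinarith

lemma jobsIn_block {j i : ℕ} (h : i < B.len * (2 * j + 1)) :
    B.jobsIn (B.len * j ^ 2 + i) = (B.T - 1) * (if i < B.b * (2 * j + 1) then 1 else 0)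
      + (if i < (B.b + B.c) * (2 * j + 1) + 1 then 1 else 0) := by
  obtain ⟨h1, h2⟩ := B.block_offset_of_lt h
  rw [jobsIn_eq]
  simp only [IsBurst, IsSampled, scale, h1, h2, Nat.lt_succ_iff]

/-- The linear term counts the one additional sample per block, at the start of its silence. -/
lemma sum_jobsIn_blocks (j : ℕ) :
    ∑ k ∈ Finset.range (B.len * j ^ 2), B.jobsIn k = (B.b * B.T + B.c) * j ^ 2 + 1 * j := by
  induction j with
  | zero => simp
  | succ j ih =>
    rw [B.sum_block, ih, Finset.sum_congr rfl fun i hi => B.jobsIn_block (Finset.mem_range.1 hi),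
      Finset.sum_add_distrib, ← Finset.mul_sum, sum_range_ite_lt, sum_range_ite_lt]
    · obtain ⟨T', hT'⟩ : ∃ T', B.T = T' + 1 := ⟨B.T - 1, by have := B.T_pos; omega⟩
      rw [hT', Nat.add_sub_cancel]
      ring
    · have := Nat.mul_pos B.s_pos (show 0 < 2 * j + 1 by omega)
      unfold len
      nlinarith
    · exact Nat.mul_le_mul_right _ (by unfold len; omega)

lemma tendsto_silent :
    Tendsto (fun n : ℕ => ((∑ k ∈ Finset.range n, (if B.IsSilent k then 1 else 0) : ℕ) : ℝ) / n)
      atTop (𝓝 ((B.s : ℝ) / B.len)) := by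
  refine tendsto_div_of_quadratic_times (B := 0) ?_ B.len_pos fun j => ?_
  · exact fun m n h => Finset.sum_le_sum_of_subset (Finset.range_mono h)
  · rw [B.sum_isSilent_blocks]; simp

lemma tendsto_count :
    Tendsto (fun t : ℕ => (Nat.count B.IsJobSlot t : ℝ) / t) atTop
      (𝓝 (((B.b * B.T + B.c : ℕ) : ℝ) / ((B.len * B.T : ℕ) : ℝ))) := by
  refine tendsto_div_of_quadratic_times (B := 1) (Nat.count_monotone _)
    (Nat.mul_pos B.len_pos B.T_pos) fun j => ?_
  have e : B.len * B.T * j ^ 2 = B.len * j ^ 2 * B.T := by ring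
  rw [← B.sum_jobsIn_blocks, Nat.count_eq_card_filter_range, Finset.card_filter, e]
  have := B.sum_isJobSlot_periods (Nat.zero_le (B.len * j ^ 2))
  rw [zero_mul, Nat.Ico_zero_eq_range, Nat.Ico_zero_eq_range] at this
  exact this

lemma infinite_isJobSlot : {t | B.IsJobSlot t}.Infinite := by
  refine Set.infinite_of_forall_exists_gt (α := ℕ) fun m => ?_
  have h0 := (B.block_offset_of_lt (j := m + 1) (i := 0)
    (Nat.mul_pos B.len_pos (by omega)))
  have : B.IsJobSlot (B.len * (m + 1) ^ 2 * B.T) := by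
    refine B.isJobSlot_mul ?_
    have h2 := h0.2
    rw [add_zero] at h2
    unfold IsSampled
    rw [h2]
    exact Nat.zero_le _
  have h2 := B.len_pos
  have h3 := B.T_pos
  refine ⟨_, this, ?_⟩
  have : m + 1 ≤ B.len * (m + 1) ^ 2 * B.T := by
    calc m + 1 = 1 * (m + 1) ^ 1 * 1 := by ring
      _ ≤ _ := by gcongr <;> omega
  omega

/-- The end points of the runs of silent periods before period `n`. -/
def silentEnds (n : ℕ) : Finset ℕ :=
  (Finset.range n).filter fun k => B.IsSilent k ∧ ¬ B.IsSilent (k + 1)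

/-- A silent run can end only with the last period of a block, so the ends inject into the block
numbers, which are at most `√n`. -/
lemma card_silentEnds_le (n : ℕ) : (B.silentEnds n).card ≤ Nat.sqrt n + 1 := by
  rw [← Finset.card_range (Nat.sqrt n + 1)]
  have hmem : ∀ k ∈ B.silentEnds n, B.offset k + 1 = B.len * B.scale k := by
    intro k hk
    obtain ⟨-, h1, h2⟩ := Finset.mem_filter.1 hk
    unfold IsSilent at h1 h2
    have h3 := B.offset_lt k
    by_contra hne
    obtain ⟨h4, h5⟩ := B.block_offset_of_lt (j := B.block k) (i := B.offset k + 1)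
      (by change _ < B.len * B.scale k; omega)
    rw [← add_assoc, B.len_mul_block_sq_add_offset] at h4 h5
    unfold scale at h2
    rw [h4, h5] at h2
    unfold scale at h1
    omega
  refine Finset.card_le_card_of_injOn B.block ?_ ?_
  · intro k hk
    simp only [silentEnds, Finset.coe_filter, Finset.mem_range, Set.mem_ofPred_eq] at hk
    simp only [Finset.coe_range, Set.mem_Iio, Nat.lt_succ_iff, block]
    exact Nat.sqrt_le_sqrt ((Nat.div_le_self _ _).trans hk.1.le)
  · intro k hk k' hk' h
    have h1 := hmem k hk
    have h2 := hmem k' hk'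
    have h3 := B.len_mul_block_sq_add_offset k
    have h4 := B.len_mul_block_sq_add_offset k'
    unfold scale at h1 h2
    rw [h] at h1 h3
    omega

/-- The product bounds the joint entropy of the queue lengths at the ends of the silent runs; it is
of order at most `√n log n`. -/
lemma tendsto_card_silentEnds_mul_log :
    Tendsto (fun n : ℕ => ((B.silentEnds n).card : ℝ) * Real.log ((n * B.T + 1 : ℕ) : ℝ) / n)
      atTop (𝓝 0) := by
  have hlog : Tendsto (fun n : ℕ => Real.log (n : ℝ) / (n : ℝ) ^ (1 / 2 : ℝ)) atTop (𝓝 0) :=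
    (isLittleO_log_rpow_atTop (by norm_num : (0 : ℝ) < 1 / 2)).tendsto_div_nhds_zero.comp
      tendsto_natCast_atTop_atTop
  have hinv : Tendsto (fun n : ℕ => 1 / (n : ℝ) ^ (1 / 2 : ℝ)) atTop (𝓝 0) := by
    have := (tendsto_rpow_neg_atTop (by norm_num : (0 : ℝ) < 1 / 2)).comp
      tendsto_natCast_atTop_atTop
    refine this.congr fun n => ?_
    simp only [Function.comp]
    rw [Real.rpow_neg (by positivity), one_div (_ ^ _)]
  have hsum := ((hlog.add (hinv.const_mul (Real.log (B.T + 1 : ℝ)))).const_mul 2)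
  simp only [mul_zero, add_zero] at hsum
  refine tendsto_of_tendsto_of_tendsto_of_le_of_le' tendsto_const_nhds hsum
    (Eventually.of_forall fun n => by positivity) ?_
  filter_upwards [eventually_gt_atTop 0] with n hn
  have hnr : (1 : ℝ) ≤ n := by exact_mod_cast hn
  have hsq : (n : ℝ) ^ (1 / 2 : ℝ) = Real.sqrt n := (Real.sqrt_eq_rpow _).symm
  have hs1 : (1 : ℝ) ≤ Real.sqrt n := Real.one_le_sqrt.2 hnr
  have hcard : ((B.silentEnds n).card : ℝ) ≤ 2 * Real.sqrt n := by
    have h1 : ((B.silentEnds n).card : ℝ) ≤ (Nat.sqrt n : ℝ) + 1 := by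
      exact_mod_cast B.card_silentEnds_le n
    have h2 := Real.nat_sqrt_le_real_sqrt (a := n)
    linarith
  have hlogle : Real.log ((n * B.T + 1 : ℕ) : ℝ) ≤ Real.log n + Real.log (B.T + 1 : ℝ) := by
    rw [← Real.log_mul (by positivity) (by positivity)]
    refine Real.log_le_log (by positivity) ?_
    push_cast
    nlinarith
  have hlog0 : 0 ≤ Real.log ((n * B.T + 1 : ℕ) : ℝ) := Real.log_natCast_nonneg _
  rw [hsq]
  have hnn : (n : ℝ) = Real.sqrt n * Real.sqrt n := (Real.mul_self_sqrt (by positivity)).symm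
  calc ((B.silentEnds n).card : ℝ) * Real.log ((n * B.T + 1 : ℕ) : ℝ) / n
      ≤ (2 * Real.sqrt n) * (Real.log n + Real.log (B.T + 1 : ℝ)) / n := by gcongr
    _ = _ := by
      nth_rewrite 3 [hnn]
      field_simp

end BlockPlan

end FCFS

namespace FCFS

/-! ### Finitely many coordinates of the arrival process -/

/-- The arrival sequence that starts with `s` and has no arrivals afterwards. -/
def extendFalse {M : ℕ} (s : Fin M → Bool) (j : ℕ) : Bool :=
  if h : j < M then s ⟨j, h⟩ else false

lemma extendFalse_apply {M : ℕ} (s : Fin M → Bool) {j : ℕ} (h : j < M) :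
    extendFalse s j = s ⟨j, h⟩ := dif_pos h

lemma apply_extendFalse {α : Type*} {M : ℕ} {f : (ℕ → Bool) → α}
    (hf : DependsOn f (Set.Iio M)) (x : ℕ → Bool) :
    f (extendFalse fun i : Fin M => x i) = f x :=
  hf fun _ hj => extendFalse_apply _ hj

section Probability

variable {Ω : Type*} [MeasurableSpace Ω] {P : Measure Ω} {δ : ℕ → Ω → Bool}

lemma measurableSet_firstSlots (hδ : ∀ j, Measurable (δ j)) (M : ℕ) (A : Set (Fin M → Bool)) :
    MeasurableSet ((fun ω (i : Fin M) => δ i ω) ⁻¹' A) :=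
  (measurable_pi_lambda (fun ω (i : Fin M) => δ i ω) fun i => hδ i) A.toFinite.measurableSet

lemma measurableSet_of_dependsOn {α : Type*} (hδ : ∀ j, Measurable (δ j)) {M : ℕ}
    {f : (ℕ → Bool) → α} (hf : DependsOn f (Set.Iio M)) (y : α) :
    MeasurableSet {ω | f (fun j => δ j ω) = y} := by
  convert measurableSet_firstSlots hδ M {s | f (extendFalse s) = y} using 1
  ext ω
  simp [apply_extendFalse hf fun j => δ j ω]

lemma integral_toNat [IsProbabilityMeasure P] {d : Ω → Bool} (hd : Measurable d) :
    ∫ ω, ((d ω).toNat : ℝ) ∂P = P.real {ω | d ω = true} := by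
  have : (fun ω => ((d ω).toNat : ℝ)) = Set.indicator {ω | d ω = true} 1 := by
    ext ω
    cases h : d ω <;> simp [Set.indicator, h]
  rw [this, integral_indicator_one]
  exact hd (measurableSet_singleton true)

/-- Hoeffding's bound for the lower tail of the number of arrivals in a set of slots. -/
lemma measureReal_sum_le [IsProbabilityMeasure P] {lam : ℝ} (hδ : ∀ j, Measurable (δ j))
    (hind : iIndepFun δ P) (hlaw : ∀ j, P.real {ω | δ j ω = true} = lam) (I : Finset ℕ)
    {ε : ℝ} (hε : 0 ≤ ε) :
    P.real {ω | ((∑ t ∈ I, (δ t ω).toNat : ℕ) : ℝ) ≤ lam * I.card - ε}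
      ≤ Real.exp (-(2 * ε ^ 2 / I.card)) := by
  let X : ℕ → Ω → ℝ := fun t ω => lam - ((δ t ω).toNat : ℝ)
  have hcast : Measurable fun x : Bool => lam - (x.toNat : ℝ) := measurable_of_finite _
  have hX : iIndepFun X P := hind.comp (fun _ x => lam - (x.toNat : ℝ)) fun _ => hcast
  have hXm : ∀ t, Measurable (X t) := fun t => hcast.comp (hδ t)
  have hsub : ∀ t ∈ I, HasSubgaussianMGF (X t) ((‖lam - (lam - 1)‖₊ / 2) ^ 2) P := by
    intro t _
    refine hasSubgaussianMGF_of_mem_Icc_of_integral_eq_zero (hXm t).aemeasurable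
      (ae_of_all _ fun ω => ?_) ?_
    · cases h : δ t ω <;> simp [X, h]
    · have hm : Measurable fun ω => ((δ t ω).toNat : ℝ) :=
        (measurable_of_finite fun x : Bool => (x.toNat : ℝ)).comp (hδ t)
      have hint : Integrable (fun ω => ((δ t ω).toNat : ℝ)) P :=
        Integrable.of_mem_Icc 0 1 hm.aemeasurable
          (ae_of_all _ fun ω => by cases h : δ t ω <;> simp)
      simp only [X]
      rw [integral_sub (integrable_const _) hint, integral_toNat (hδ t), hlaw]
      simp
  have := HasSubgaussianMGF.measure_sum_ge_le_of_iIndepFun hX (s := I) hsub hε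
  refine le_trans (measureReal_mono ?_) (this.trans (Real.exp_le_exp.2 (le_of_eq ?_)))
  · intro ω hω
    simp only [Set.mem_ofPred_eq, Nat.cast_sum] at hω ⊢
    simp only [X, Finset.sum_sub_distrib, Finset.sum_const, nsmul_eq_mul]
    linarith
  · have e : ‖lam - (lam - 1)‖₊ = 1 := by simp
    rw [e, Finset.sum_const, nsmul_eq_mul]
    push_cast
    rcases eq_or_ne (I.card : ℝ) 0 with h0 | h0
    · simp [h0]
    · field_simp

end Probability

/-! ### The attack, and what its transcript leaves open about each period -/

namespace BlockPlan

variable (B : BlockPlan)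

/-- The issue times of the attack. -/
noncomputable def issue : ℕ → ℕ := Nat.nth B.IsJobSlot

lemma strictMono_issue : StrictMono B.issue := Nat.nth_strictMono B.infinite_isJobSlot

lemma tendsto_rate :
    Tendsto (fun k : ℕ => ((k : ℝ) + 1) / (B.issue k : ℝ)) atTop
      (𝓝 (((B.b * B.T + B.c : ℕ) : ℝ) / ((B.len * B.T : ℕ) : ℝ))) := by
  have h1 := B.tendsto_count.comp B.strictMono_issue.tendsto_atTop
  have h2 : Tendsto (fun k : ℕ => 1 / (B.issue k : ℝ)) atTop (𝓝 0) :=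
    tendsto_one_div_atTop_nhds_zero_nat.comp B.strictMono_issue.tendsto_atTop
  have h3 := h1.add h2
  rw [add_zero] at h3
  refine h3.congr fun k => ?_
  simp only [Function.comp]
  rw [show Nat.count B.IsJobSlot (B.issue k) = k from
    Nat.count_nth_of_infinite B.infinite_isJobSlot k, add_div]

lemma sum_attackerJobs {k₁ k₂ : ℕ} (h : k₁ ≤ k₂) :
    ∑ t ∈ Finset.Ico (k₁ * B.T) (k₂ * B.T), attackerJobs B.issue t
      = ∑ k ∈ Finset.Ico k₁ k₂, B.jobsIn k := by
  rw [← B.sum_isJobSlot_periods h]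
  refine Finset.sum_congr rfl fun t _ => ?_
  rw [issue, attackerJobs_nth B.infinite_isJobSlot]
  split_ifs <;> rfl

/-- What the transcript may fail to reveal about period `k`: everything if the period is silent,
otherwise nothing unless the server has idled. -/
noncomputable def residue (k : ℕ) (d : ℕ → Bool) : Option ℕ :=
  if ¬ B.IsSilent k ∧ jobPattern B.T d k + B.jobsIn k + queue B.issue d (k * B.T)
      = queue B.issue d ((k + 1) * B.T) + B.T then none
  else some (jobPattern B.T d k)

/-- If the residue is `none`, work is balanced over the period, so the count follows from the queue
lengths at its two ends, and both are sampled. Otherwise the residue is the count itself. -/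
lemma jobPattern_eq_of_residue_eq {n k : ℕ} (hk : k < n) {d d' : ℕ → Bool}
    (hZ : transcript B.T B.issue d n = transcript B.T B.issue d' n)
    (hR : B.residue k d = B.residue k d') :
    jobPattern B.T d k = jobPattern B.T d' k := by
  rw [issue, transcript_eq_iff B.infinite_isJobSlot] at hZ
  unfold residue at hR
  split_ifs at hR with h1 h2 h2
  · have e1 := hZ (k * B.T) (Nat.mul_le_mul_right _ hk.le)
      (B.isJobSlot_mul (B.isSampled_of_not_isSilent h1.1))
    have e2 := hZ ((k + 1) * B.T) (Nat.mul_le_mul_right _ hk)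
      (B.isJobSlot_mul (B.isSampled_succ h1.1))
    have h3 := h1.2
    have h4 := h2.2
    rw [issue] at h3 h4
    omega
  · exact Option.some.inj hR

lemma residue_mem (k : ℕ) (d : ℕ → Bool) :
    B.residue k d ∈ Finset.insertNone (Finset.range (B.T + 1)) := by
  unfold residue
  split_ifs
  · simp
  · simpa [Nat.lt_succ_iff] using jobPattern_le B.T d k

lemma dependsOn_queue (a : ℕ → ℕ) {t M : ℕ} (h : t ≤ M) :
    DependsOn (fun d => queue a d t) (Set.Iio M) :=
  fun _ _ hd => queue_congr a fun j hj => hd j (lt_of_lt_of_le hj h)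

lemma dependsOn_jobPattern (T k : ℕ) {M : ℕ} (h : (k + 1) * T ≤ M) :
    DependsOn (fun d => jobPattern T d k) (Set.Iio M) :=
  fun _ _ hd => jobPattern_congr fun j _ hj => hd j (lt_of_lt_of_le hj h)

lemma dependsOn_residue (k : ℕ) {M : ℕ} (h : (k + 1) * B.T ≤ M) :
    DependsOn (B.residue k) (Set.Iio M) := by
  intro d d' hd
  have h' : k * B.T ≤ M := (Nat.mul_le_mul_right _ (Nat.le_succ k)).trans h
  have e1 : jobPattern B.T d k = _ := dependsOn_jobPattern B.T k h hd
  have e2 : queue B.issue d (k * B.T) = _ := dependsOn_queue B.issue h' hd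
  have e3 : queue B.issue d ((k + 1) * B.T) = _ := dependsOn_queue B.issue h hd
  simp only [residue, e1, e2, e3]

lemma residue_eq_none_of_busy {k : ℕ} (hk : ¬ B.IsSilent k) {d : ℕ → Bool}
    (h : queue B.issue d (k * B.T) + ∑ t ∈ Finset.Ico (k * B.T) ((k + 1) * B.T),
      (attackerJobs B.issue t + (d t).toNat)
      = queue B.issue d ((k + 1) * B.T) + ((k + 1) * B.T - k * B.T)) :
    B.residue k d = none := by
  refine if_pos ⟨hk, ?_⟩
  rw [Finset.sum_add_distrib, B.sum_attackerJobs (Nat.le_succ k), Nat.Ico_succ_singleton,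
    Finset.sum_singleton, add_mul, one_mul] at h
  rw [jobPattern, add_mul, one_mul]
  omega

/-- The attacker's own job in every slot keeps the server busy, whatever the user does. -/
lemma residue_of_isBurst {k : ℕ} (hk : B.IsBurst k) (d : ℕ → Bool) : B.residue k d = none := by
  refine B.residue_eq_none_of_busy (B.not_isSilent_of_isBurst hk)
    (queue_add_sub_eq _ _ (Nat.mul_le_mul_right _ (Nat.le_succ k)) fun t ht => ?_)
  rw [issue, attackerJobs_nth B.infinite_isJobSlot, if_pos]
  · omega
  · left
    rwa [div_eq_of_mem ht]

lemma residue_of_le_queue {k : ℕ} (hk : ¬ B.IsSilent k) {d : ℕ → Bool}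
    (h : B.T ≤ queue B.issue d (k * B.T)) : B.residue k d = none := by
  refine B.residue_eq_none_of_busy hk
    (queue_add_sub_eq_of_le _ _ (Nat.mul_le_mul_right _ (Nat.le_succ k)) ?_)
  rw [add_mul, one_mul]
  omega

/-- A lower bound for the queue length in the second phase of a block. -/
lemma queue_lower_bound {k : ℕ} (h1 : ¬ B.IsBurst k) (h2 : ¬ B.IsSilent k) (d : ℕ → Bool) :
    (B.T - 1) * (B.b * B.scale k) + B.offset k
      + ∑ t ∈ Finset.Ico (B.len * B.block k ^ 2 * B.T) (k * B.T), (d t).toNat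
      ≤ queue B.issue d (k * B.T) + B.offset k * B.T := by
  have e := B.len_mul_block_sq_add_offset k
  have hle : B.len * B.block k ^ 2 ≤ k := by omega
  have := queue_add_sub_ge B.issue d (Nat.mul_le_mul_right B.T hle)
  rw [Finset.sum_add_distrib, B.sum_attackerJobs hle] at this
  have e2 : k * B.T - B.len * B.block k ^ 2 * B.T = B.offset k * B.T := by
    rw [← Nat.sub_mul]; rfl
  rw [e2] at this
  have e3 : ∑ k' ∈ Finset.Ico (B.len * B.block k ^ 2) k, B.jobsIn k'
      = (B.T - 1) * (B.b * B.scale k) + B.offset k := by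
    rw [Finset.sum_Ico_eq_sum_range]
    change ∑ i ∈ Finset.range (B.offset k), _ = _
    unfold IsBurst at h1
    unfold IsSilent at h2
    have hlt := B.offset_lt k
    rw [Finset.sum_congr rfl fun i hi =>
      B.jobsIn_block (lt_trans (Finset.mem_range.1 hi) hlt), Finset.sum_add_distrib,
      ← Finset.mul_sum]
    change (B.T - 1) * ∑ i ∈ Finset.range (B.offset k), (if i < B.b * B.scale k then 1 else 0)
      + ∑ i ∈ Finset.range (B.offset k), (if i < (B.b + B.c) * B.scale k + 1 then 1 else 0) = _
    rw [sum_range_ite_lt (by omega), Finset.sum_congr rfl (g := fun _ => 1)]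
    · simp
    · intro i hi
      rw [Finset.mem_range] at hi
      rw [if_pos (by omega)]
  omega

lemma tendsto_scale : Tendsto B.scale atTop atTop := by
  refine tendsto_atTop_atTop.2 fun m => ⟨B.len * m ^ 2, fun n hn => ?_⟩
  have : m ≤ B.block n := by
    unfold block
    rw [Nat.le_sqrt', Nat.le_div_iff_mul_le B.len_pos]
    linarith [mul_comm B.len (m ^ 2)]
  unfold scale
  omega

section Probability

variable {Ω : Type*} [MeasurableSpace Ω] {P : Measure Ω} [IsProbabilityMeasure P]
  {δ : ℕ → Ω → Bool} {lam : ℝ}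

/-- The surplus, per unit of scale, of the work that the bursts bring over the capacity that is
left unused up to the end of the second phase. -/
noncomputable def surplus (lam : ℝ) : ℝ := B.b * B.T * lam - B.c * ((1 - lam) * B.T - 1)

/-- A nontrivial residue forces a queue shorter than `T` at the start of the period. The user's
arrivals since the start of the block then fall short of their mean by at least half the surplus
times the scale; `hbig` lets the other half absorb the `T`. Hoeffding's bound applies to this
deficit. -/
lemma measureReal_residue_le (hδ : ∀ j, Measurable (δ j))
    (hind : iIndepFun δ P) (hlaw : ∀ j, P.real {ω | δ j ω = true} = lam)
    (hT : 1 ≤ (1 - lam) * B.T) (hD : 0 < B.surplus lam) {k : ℕ} (h2 : ¬ B.IsSilent k)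
    (hbig : B.T ≤ B.surplus lam / 2 * B.scale k) :
    P.real {ω | B.residue k (fun j => δ j ω) ≠ none}
      ≤ Real.exp (-(B.surplus lam ^ 2 / (2 * (B.len * B.T : ℕ)) * B.scale k)) := by
  by_cases h1 : B.IsBurst k
  · simp only [B.residue_of_isBurst h1, ne_eq, not_true_eq_false]
    simpa using (Real.exp_pos _).le
  -- Without bursts the surplus could not be positive. Consequently the offset of `k` is positive
  -- and Hoeffding's denominator is not 0.
  have hb : 0 < B.b := by
    by_contra hb
    have : B.b = 0 := by omega
    unfold surplus at hD
    rw [this] at hD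
    have : (0 : ℝ) ≤ B.c * ((1 - lam) * B.T - 1) := by
      have := sub_nonneg.2 hT
      positivity
    norm_num at hD
    linarith
  have hTp := B.T_pos
  have hN : 0 < B.scale k := by unfold scale; omega
  set D := B.surplus lam with hDdef
  set I := Finset.Ico (B.len * B.block k ^ 2 * B.T) (k * B.T) with hI
  have hcard : I.card = B.offset k * B.T := by
    rw [hI, Nat.card_Ico, ← Nat.sub_mul]; rfl
  have hoff : 0 < B.offset k := by
    unfold IsBurst at h1
    have := Nat.mul_pos hb hN
    omega
  have hε : 0 ≤ D / 2 * B.scale k := by positivity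
  refine le_trans (measureReal_mono ?_) ((measureReal_sum_le hδ hind hlaw I hε).trans ?_)
  · intro ω hω
    simp only [Set.mem_ofPred_eq] at hω ⊢
    have hq : queue B.issue (fun j => δ j ω) (k * B.T) < B.T := by
      by_contra h
      exact hω (B.residue_of_le_queue h2 (not_lt.1 h))
    have hlow := B.queue_lower_bound h1 h2 fun j => δ j ω
    rw [← hI] at hlow
    have hlt : (B.T - 1) * (B.b * B.scale k) + B.offset k + ∑ t ∈ I, (δ t ω).toNat
        ≤ B.T + B.offset k * B.T := by omega
    have hltr : ((B.T : ℝ) - 1) * (B.b * B.scale k) + B.offset k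
        + ((∑ t ∈ I, (δ t ω).toNat : ℕ) : ℝ) ≤ B.T + B.offset k * B.T := by
      have : ((B.T - 1 : ℕ) : ℝ) = (B.T : ℝ) - 1 := by
        rw [Nat.cast_sub (by omega)]; simp
      rw [← this]
      exact_mod_cast hlt
    have hoffle : (B.offset k : ℝ) ≤ (B.b + B.c) * B.scale k := by
      have := B.isSampled_of_not_isSilent h2
      unfold IsSampled at this
      exact_mod_cast this
    rw [hcard]
    push_cast at hltr ⊢
    -- The mean backlog does not grow in the second phase, so the end of that phase is the worst
    -- case.
    have e : ((1 - lam) * B.T - 1) * B.offset k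
        ≤ ((1 - lam) * B.T - 1) * ((B.b + B.c) * B.scale k) :=
      mul_le_mul_of_nonneg_left hoffle (sub_nonneg.2 hT)
    have e2 : D * B.scale k = ((B.T : ℝ) - 1) * (B.b * B.scale k)
        - ((1 - lam) * B.T - 1) * ((B.b + B.c) * B.scale k) := by
      rw [hDdef, surplus]; ring
    linarith
  · refine Real.exp_le_exp.2 (neg_le_neg ?_)
    rw [hcard]
    have hlt : (B.offset k : ℝ) ≤ B.len * B.scale k := by exact_mod_cast (B.offset_lt k).le
    have hL := B.len_pos
    have hoffr : (0 : ℝ) < B.offset k := by exact_mod_cast hoff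
    have hTr : (0 : ℝ) < B.T := by exact_mod_cast hTp
    have hNr : (0 : ℝ) < B.scale k := by exact_mod_cast hN
    have hLr : (0 : ℝ) < B.len := by exact_mod_cast hL
    push_cast
    rw [le_div_iff₀ (by positivity)]
    calc D ^ 2 / (2 * (B.len * B.T)) * B.scale k * (B.offset k * B.T)
        ≤ D ^ 2 / (2 * (B.len * B.T)) * B.scale k * (B.len * B.scale k * B.T) := by gcongr
      _ = 2 * (D / 2 * B.scale k) ^ 2 := by field_simp

lemma tendsto_measureReal_residue (hδ : ∀ j, Measurable (δ j))
    (hind : iIndepFun δ P) (hlaw : ∀ j, P.real {ω | δ j ω = true} = lam)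
    (hT : 1 ≤ (1 - lam) * B.T) (hD : 0 < B.surplus lam) :
    Tendsto (fun k => if B.IsSilent k then 0
      else P.real {ω | B.residue k (fun j => δ j ω) ≠ none}) atTop (𝓝 0) := by
  have hLT : 0 < B.len * B.T := Nat.mul_pos B.len_pos B.T_pos
  have hsc : Tendsto (fun k => (B.scale k : ℝ)) atTop atTop :=
    tendsto_natCast_atTop_atTop.comp B.tendsto_scale
  have hκ : 0 < B.surplus lam ^ 2 / (2 * (B.len * B.T : ℕ)) := by
    have : (0 : ℝ) < (B.len * B.T : ℕ) := by exact_mod_cast hLT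
    positivity
  have hexp := Real.tendsto_exp_neg_atTop_nhds_zero.comp (hsc.const_mul_atTop hκ)
  refine tendsto_of_tendsto_of_tendsto_of_le_of_le' tendsto_const_nhds hexp
    (Eventually.of_forall fun k => by split_ifs <;> positivity) ?_
  filter_upwards [(hsc.const_mul_atTop (half_pos hD)).eventually_ge_atTop (B.T : ℝ)] with k hk
  split_ifs with h
  · exact (Real.exp_pos _).le
  · exact B.measureReal_residue_le hδ hind hlaw hT hD h hk

/-- The entropy, in nats, of the residue of period `k`. -/
noncomputable def residueEntropy (P : Measure Ω) (δ : ℕ → Ω → Bool) (k : ℕ) : ℝ :=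
  ∑ y ∈ Finset.insertNone (Finset.range (B.T + 1)),
    Real.negMulLog (P.real {ω | B.residue k (fun j => δ j ω) = y})

lemma tendsto_residueEntropy (hδ : ∀ j, Measurable (δ j))
    (hind : iIndepFun δ P) (hlaw : ∀ j, P.real {ω | δ j ω = true} = lam)
    (hT : 1 ≤ (1 - lam) * B.T) (hD : 0 < B.surplus lam) :
    Tendsto (fun k => if B.IsSilent k then 0 else B.residueEntropy P δ k) atTop (𝓝 0) := by
  have hr := B.tendsto_measureReal_residue hδ hind hlaw hT hD
  -- On silent periods the law is replaced by the point mass at `none`, of entropy 0, so that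
  -- convergence holds along all `k`.
  let u : Option ℕ → ℕ → ℝ := fun y k => if B.IsSilent k then (if y = none then 1 else 0)
    else P.real {ω | B.residue k (fun j => δ j ω) = y}
  have hu : ∀ y, Tendsto (u y) atTop (𝓝 (if y = none then 1 else 0)) := by
    intro y
    cases y with
    | none =>
      have := hr.const_sub 1
      rw [sub_zero] at this
      rw [if_pos rfl]
      refine this.congr fun k => ?_
      simp only [u, if_true]
      split_ifs with h
      · simp
      · have hm := measurableSet_of_dependsOn hδ (B.dependsOn_residue k le_rfl) none
        rw [← probReal_compl_eq_one_sub (μ := P)]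
        · congr 1
          ext ω
          simp
        · exact hm.compl
    | some x =>
      rw [if_neg (by simp)]
      refine squeeze_zero (fun k => ?_) (fun k => ?_) hr
      · simp only [u]
        split_ifs <;> positivity
      · simp only [u]
        split_ifs with h h'
        · simp at h'
        · exact le_rfl
        · exact measureReal_mono fun ω hω => by
            simp only [Set.mem_ofPred_eq] at hω ⊢
            simp [hω]
  have hsum : Tendsto (fun k => ∑ y ∈ Finset.insertNone (Finset.range (B.T + 1)),
      Real.negMulLog (u y k)) atTop (𝓝 (∑ y ∈ Finset.insertNone (Finset.range (B.T + 1)),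
        Real.negMulLog (if y = none then 1 else 0))) :=
    tendsto_finsetSum _ fun y _ => (Real.continuous_negMulLog.tendsto _).comp (hu y)
  have h0 : ∀ y : Option ℕ, Real.negMulLog (if y = none then 1 else 0) = 0 := by
    intro y; split_ifs <;> simp
  simp only [h0, Finset.sum_const_zero] at hsum
  refine hsum.congr fun k => ?_
  simp only [u, residueEntropy]
  split_ifs with h
  · exact Finset.sum_eq_zero fun y _ => h0 y
  · rfl

end Probability

end BlockPlan

end FCFS

/-! ### Entropy under the law of finitely many arrivals -/

namespace FCFS

open FiniteEntropy

section Law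

variable {Ω : Type*} [MeasurableSpace Ω] {P : Measure Ω} {δ : ℕ → Ω → Bool}

/-- The law of the first `M` arrivals, as a weight function. -/
noncomputable def slotLaw (P : Measure Ω) (δ : ℕ → Ω → Bool) (M : ℕ) (s : Fin M → Bool) : ℝ :=
  P.real ((fun ω (i : Fin M) => δ i ω) ⁻¹' {s})

lemma slotLaw_nonneg (M : ℕ) (s : Fin M → Bool) : 0 ≤ slotLaw P δ M s := measureReal_nonneg

variable [IsProbabilityMeasure P]

lemma mass_slotLaw (hδ : ∀ j, Measurable (δ j)) {α : Type*} {M : ℕ} (f : (Fin M → Bool) → α)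
    (y : α) : mass (slotLaw P δ M) f y = P.real {ω | f (fun i => δ i ω) = y} :=
  mass_eq_measureReal (fun s => measurableSet_firstSlots hδ M {s}) f y

lemma sum_slotLaw (hδ : ∀ j, Measurable (δ j)) (M : ℕ) : ∑ s, slotLaw P δ M s = 1 := by
  have := mass_slotLaw (P := P) hδ (M := M) (fun _ => ()) ()
  simpa [mass] using this

lemma ent_slotLaw_eq_sum (hδ : ∀ j, Measurable (δ j)) {α : Type*} {M : ℕ} {f : (ℕ → Bool) → α}
    (hf : DependsOn f (Set.Iio M)) {Y : Finset α} (hY : ∀ d, f d ∈ Y) :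
    ent (slotLaw P δ M) (fun s => f (extendFalse s))
      = ∑ y ∈ Y, Real.negMulLog (P.real {ω | f (fun j => δ j ω) = y}) := by
  rw [ent_eq_sum (fun s : Fin M → Bool => f (extendFalse s)) fun s => hY _]
  refine Finset.sum_congr rfl fun y _ => ?_
  rw [mass_slotLaw hδ]
  congr 3
  ext ω
  rw [apply_extendFalse hf fun j => δ j ω]

/-- Functions of disjoint sets of arrivals have additive entropies. -/
lemma ent_slotLaw_prod (hδ : ∀ j, Measurable (δ j)) (hind : iIndepFun δ P) {α β : Type*} {M : ℕ}
    (A : Finset (Fin M)) {f : (Fin M → Bool) → α} {g : (Fin M → Bool) → β}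
    (hf : DependsOn f (A : Set (Fin M))) (hg : DependsOn g ((A : Set (Fin M))ᶜ)) :
    ent (slotLaw P δ M) (fun s => (f s, g s))
      = ent (slotLaw P δ M) f + ent (slotLaw P δ M) g := by
  classical
  refine ent_prod_eq (slotLaw_nonneg M) f g fun x y => ?_
  simp only [mass_slotLaw hδ, Prod.mk.injEq]
  have h1 : iIndepFun (fun i : Fin M => δ i) P := hind.precomp Fin.val_injective
  have h2 := h1.indepFun_finset A Aᶜ disjoint_compl_right fun i => hδ i
  -- Fills the coordinates outside `C` with a default that a function of the coordinates in `C`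
  -- cannot see.
  let r (C : Finset (Fin M)) (u : C → Bool) (i : Fin M) : Bool :=
    if h : i ∈ C then u ⟨i, h⟩ else false
  have e1 : ∀ s : Fin M → Bool, f (r A fun i => s i) = f s := fun s =>
    hf fun i hi => by simp [r, Finset.mem_coe.1 hi]
  have e2 : ∀ s : Fin M → Bool, g (r Aᶜ fun i => s i) = g s := fun s =>
    hg fun i hi => by
      have hi' : i ∈ Aᶜ := by simpa using hi
      simp [r, hi']
  have h3 := h2.measure_inter_preimage_eq_mul {u | f (r A u) = x} {u | g (r Aᶜ u) = y}
    (Set.toFinite _).measurableSet (Set.toFinite _).measurableSet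
  have s1 : (fun ω (i : A) => δ i ω) ⁻¹' {u | f (r A u) = x}
      = {ω | f (fun i => δ i ω) = x} := by
    ext ω
    simp [e1 fun i => δ i ω]
  have s2 : (fun ω (i : (Aᶜ : Finset (Fin M))) => δ i ω) ⁻¹' {u | g (r Aᶜ u) = y}
      = {ω | g (fun i => δ i ω) = y} := by
    ext ω
    simp [e2 fun i => δ i ω]
  rw [s1, s2] at h3
  have h4 := congrArg ENNReal.toReal h3
  rw [ENNReal.toReal_mul] at h4
  exact h4

/-- The job counts of all periods have the same law. -/
lemma measureReal_jobPattern (hδ : ∀ j, Measurable (δ j)) (hind : iIndepFun δ P) {lam : ℝ}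
    (hlaw : ∀ j, P.real {ω | δ j ω = true} = lam) (T k x : ℕ) :
    P.real {ω | jobPattern T (fun j => δ j ω) k = x}
      = P.real {ω | jobPattern T (fun j => δ j ω) 0 = x} := by
  have hmap : ∀ i j, P.map (δ i) = P.map (δ j) := by
    intro i j
    have := Measure.isProbabilityMeasure_map (μ := P) (hδ i).aemeasurable
    have := Measure.isProbabilityMeasure_map (μ := P) (hδ j).aemeasurable
    have ht : ∀ l, (P.map (δ l)).real {true} = lam := fun l => by
      rw [map_measureReal_apply (hδ l) (measurableSet_singleton _)]
      exact hlaw l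
    have hf : ∀ l, (P.map (δ l)).real {false} = 1 - lam := fun l => by
      have := Measure.isProbabilityMeasure_map (μ := P) (hδ l).aemeasurable
      rw [← ht l, ← probReal_compl_eq_one_sub (measurableSet_singleton _)]
      congr 1
      ext b
      cases b <;> simp
    refine Measure.ext_of_singleton fun b => ?_
    rw [← ENNReal.toReal_eq_toReal_iff' (measure_ne_top _ _) (measure_ne_top _ _)]
    cases b
    · exact (hf i).trans (hf j).symm
    · exact (ht i).trans (ht j).symm
  have hid : ∀ i j, IdentDistrib (δ i) (δ j) P P := fun i j =>
    ⟨(hδ i).aemeasurable, (hδ j).aemeasurable, hmap i j⟩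
  have hpi : IdentDistrib (fun ω (i : Fin T) => δ (k * T + i) ω) (fun ω (i : Fin T) => δ i ω) P P :=
    IdentDistrib.pi (X := fun i : Fin T => δ (k * T + i)) (Y := fun i : Fin T => δ i)
      (fun i => hid _ _)
      (hind.precomp fun a b h => Fin.ext (by simpa using h)) (hind.precomp Fin.val_injective)
  have hset : ∀ k, {ω | jobPattern T (fun j => δ j ω) k = x}
      = (fun ω (i : Fin T) => δ (k * T + i) ω) ⁻¹' {u | ∑ i, (u i).toNat = x} := by
    intro k
    ext ω
    simp only [jobPattern, Set.mem_ofPred_eq, Set.mem_preimage]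
    rw [Finset.sum_Ico_eq_sum_range, add_mul, one_mul, Nat.add_sub_cancel_left,
      Finset.sum_range]
  rw [hset, hset 0]
  have := hpi.measure_mem_eq (s := {u | ∑ i, (u i).toNat = x}) (Set.toFinite _).measurableSet
  simp only [zero_mul, zero_add]
  exact congrArg ENNReal.toReal this

end Law

/-! ### Matching bounds for the equivocation of a block schedule -/

namespace BlockPlan

variable (B : BlockPlan) {Ω : Type*} [MeasurableSpace Ω] {P : Measure Ω} [IsProbabilityMeasure P]
  {δ : ℕ → Ω → Bool}

/-- The job counts of the first `n` periods. -/
def counts (n : ℕ) (s : Fin (n * B.T) → Bool) (k : Fin n) : ℕ :=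
  jobPattern B.T (extendFalse s) k

/-- The transcript of the first `n` periods. -/
noncomputable def observed (n : ℕ) (s : Fin (n * B.T) → Bool) : List ℕ × List ℕ :=
  transcript B.T B.issue (extendFalse s) n

lemma equivocation_eq (hδ : ∀ j, Measurable (δ j)) (n : ℕ) :
    equivocation P δ (fun k _ => B.issue k) B.T n =
      (ent (slotLaw P δ (n * B.T)) (fun s => (B.counts n s, B.observed n s))
        - ent (slotLaw P δ (n * B.T)) (B.observed n)) / Real.log 2 := by
  have := condEntropy_eq (P := P) (fun s => measurableSet_firstSlots hδ (n * B.T) {s})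
    (B.counts n) (B.observed n)
  refine Eq.trans ?_ this
  unfold equivocation
  congr 1
  · ext ω k
    exact (apply_extendFalse (dependsOn_jobPattern B.T k (Nat.mul_le_mul_right _ k.2))
      fun j => δ j ω).symm
  · ext1 ω
    exact transcript_congr B.infinite_isJobSlot B.T n fun j hj =>
      (extendFalse_apply (fun i : Fin (n * B.T) => δ i ω) hj).symm

lemma residueEntropy_eq_ent (hδ : ∀ j, Measurable (δ j)) {n k : ℕ} (hk : k < n) :
    ent (slotLaw P δ (n * B.T)) (fun s => B.residue k (extendFalse s))
      = B.residueEntropy P δ k :=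
  ent_slotLaw_eq_sum hδ (B.dependsOn_residue k (Nat.mul_le_mul_right _ hk)) (B.residue_mem k)

/-- Given the transcript, the residues determine the counts; so the equivocation is at most the
joint entropy of the residues, which is subadditive. -/
lemma equivocation_le (hδ : ∀ j, Measurable (δ j)) (n : ℕ) :
    equivocation P δ (fun k _ => B.issue k) B.T n ≤
      (∑ k ∈ Finset.range n, B.residueEntropy P δ k) / Real.log 2 := by
  rw [B.equivocation_eq hδ]
  have hp : ∀ s, 0 ≤ slotLaw P δ (n * B.T) s := slotLaw_nonneg _
  have hp1 := sum_slotLaw (P := P) hδ (n * B.T)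
  refine div_le_div_of_nonneg_right ?_ (Real.log_nonneg (by norm_num))
  have h1 := ent_pi_le hp hp1 (fun k s => B.residue k (extendFalse s)) (Finset.range n)
  rw [Finset.sum_congr rfl fun k hk =>
    B.residueEntropy_eq_ent hδ (Finset.mem_range.1 hk)] at h1
  have h2 := ent_prod_le hp hp1 (fun s (k : Finset.range n) => B.residue k (extendFalse s))
    (B.observed n)
  have h3 : ent (slotLaw P δ (n * B.T)) (fun s => (B.counts n s, B.observed n s))
      ≤ ent (slotLaw P δ (n * B.T)) (fun s =>
        (fun (k : Finset.range n) => B.residue k (extendFalse s), B.observed n s)) := by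
    refine ent_le_of_determines hp fun s s' h => ?_
    simp only [Prod.mk.injEq] at h ⊢
    refine ⟨funext fun k => ?_, h.2⟩
    exact B.jobPattern_eq_of_residue_eq k.2 h.2
      (congrFun h.1 ⟨k, Finset.mem_range.2 k.2⟩)
  linarith

/-- The entropy, in nats, of the job count of one period. -/
noncomputable def countEntropy (P : Measure Ω) (δ : ℕ → Ω → Bool) (T : ℕ) : ℝ :=
  ∑ x ∈ Finset.range (T + 1), Real.negMulLog (P.real {ω | jobPattern T (fun j => δ j ω) 0 = x})

lemma residueEntropy_of_isSilent (hδ : ∀ j, Measurable (δ j)) (hind : iIndepFun δ P) {lam : ℝ}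
    (hlaw : ∀ j, P.real {ω | δ j ω = true} = lam) {k : ℕ} (hk : B.IsSilent k) :
    B.residueEntropy P δ k = countEntropy P δ B.T := by
  have h : ∀ d, B.residue k d = some (jobPattern B.T d k) := fun d => if_neg (by simp [hk])
  simp only [residueEntropy, countEntropy, h, Finset.sum_insertNone]
  simp [measureReal_jobPattern hδ hind hlaw B.T k]

lemma countEntropy_eq_ent (hδ : ∀ j, Measurable (δ j)) (hind : iIndepFun δ P) {lam : ℝ}
    (hlaw : ∀ j, P.real {ω | δ j ω = true} = lam) {n k : ℕ} (hk : k < n) (T : ℕ) :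
    ent (slotLaw P δ (n * T)) (fun s => jobPattern T (extendFalse s) k)
      = countEntropy P δ T := by
  rw [ent_slotLaw_eq_sum hδ (dependsOn_jobPattern T k (Nat.mul_le_mul_right _ hk))
    (Y := Finset.range (T + 1)) fun d => Finset.mem_range.2 (Nat.lt_succ_of_le
      (jobPattern_le T d k))]
  simp only [countEntropy, measureReal_jobPattern hδ hind hlaw T k]

/-- The arrivals outside the silent periods. -/
def loudArrivals (n : ℕ) (s : Fin (n * B.T) → Bool) (i : Fin (n * B.T)) : Bool :=
  if B.IsSilent (i / B.T) then false else s i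

/-- The silent periods before period `n`. -/
def silentPeriods (n : ℕ) : Finset ℕ := (Finset.range n).filter B.IsSilent

/-- Each silent period uses slots disjoint from those of the other periods and from the loud slots,
so its count is independent of the rest and can be split off. -/
lemma ent_silent_counts (hδ : ∀ j, Measurable (δ j)) (hind : iIndepFun δ P) {lam : ℝ}
    (hlaw : ∀ j, P.real {ω | δ j ω = true} = lam) (n : ℕ) {I : Finset ℕ}
    (hI : I ⊆ B.silentPeriods n) :
    ent (slotLaw P δ (n * B.T)) (fun s =>
      (fun k : I => jobPattern B.T (extendFalse s) k, B.loudArrivals n s))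
      = I.card * countEntropy P δ B.T + ent (slotLaw P δ (n * B.T)) (B.loudArrivals n) := by
  classical
  have hp : ∀ s, 0 ≤ slotLaw P δ (n * B.T) s := slotLaw_nonneg _
  induction I using Finset.induction_on with
  | empty =>
    rw [ent_congr hp (g := B.loudArrivals n)]
    · simp
    · intro s s'
      simp [funext_iff]
  | insert a I ha ih =>
    obtain ⟨haI, hI'⟩ := Finset.insert_subset_iff.1 hI
    obtain ⟨han, haS⟩ := Finset.mem_filter.1 haI
    rw [Finset.mem_range] at han
    let A : Finset (Fin (n * B.T)) := Finset.univ.filter fun i => (i : ℕ) / B.T = a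
    have key := ent_slotLaw_prod (P := P) hδ hind A
      (f := fun s => jobPattern B.T (extendFalse s) a)
      (g := fun s => (fun k : I => jobPattern B.T (extendFalse s) k, B.loudArrivals n s)) ?_ ?_
    · rw [countEntropy_eq_ent hδ hind hlaw han, ih hI'] at key
      rw [Finset.card_insert_of_notMem ha]
      rw [ent_congr hp (g := fun s => (jobPattern B.T (extendFalse s) a,
        (fun k : I => jobPattern B.T (extendFalse s) k, B.loudArrivals n s))), key]
      · push_cast; ring
      · intro s s'
        simp only [Prod.mk.injEq, funext_iff, Subtype.forall, Finset.forall_mem_insert, and_assoc]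
    · intro s s' h
      refine jobPattern_congr fun j h1 h2 => ?_
      have hj : j < n * B.T := lt_of_lt_of_le h2 (Nat.mul_le_mul_right _ han)
      rw [extendFalse_apply s hj, extendFalse_apply s' hj]
      refine h _ ?_
      simp only [A, Finset.coe_filter, Finset.mem_univ, true_and, Set.mem_ofPred_eq]
      exact Nat.div_eq_of_lt_le h1 h2
    · intro s s' h
      have h' : ∀ i : Fin (n * B.T), (i : ℕ) / B.T ≠ a → s i = s' i := fun i hi =>
        h i (by simpa [A] using hi)
      refine Prod.ext (funext fun k => ?_) (funext fun i => ?_)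
      · have hkn : (k : ℕ) < n := by
          have := Finset.mem_filter.1 (hI' k.2)
          exact Finset.mem_range.1 this.1
        refine jobPattern_congr fun j h1 h2 => ?_
        have hj : j < n * B.T := lt_of_lt_of_le h2 (Nat.mul_le_mul_right _ hkn)
        rw [extendFalse_apply s hj, extendFalse_apply s' hj]
        refine h' _ ?_
        rw [show j / B.T = k from Nat.div_eq_of_lt_le h1 h2]
        rintro rfl
        exact ha k.2
      · simp only [loudArrivals]
        split_ifs with hi
        · rfl
        · refine h' i ?_
          rintro rfl
          exact hi haS

/-- Let `X` be the silent counts, `V` the loud arrivals, `Q` the queue lengths at the ends of the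
silent runs and `Z` the transcript, a function of `(V, Q)`. Then `H(X | Z) ≥ H(X | V, Q) ≥ H(X, V) -
H(V) - H(Q)`. Here `X` is independent of `V`, and each coordinate of `Q` takes at most `n * T + 1`
values. -/
lemma le_equivocation (hδ : ∀ j, Measurable (δ j)) (hind : iIndepFun δ P) {lam : ℝ}
    (hlaw : ∀ j, P.real {ω | δ j ω = true} = lam) (n : ℕ) :
    ((B.silentPeriods n).card * countEntropy P δ B.T
      - (B.silentEnds n).card * Real.log ((n * B.T + 1 : ℕ) : ℝ)) / Real.log 2
      ≤ equivocation P δ (fun k _ => B.issue k) B.T n := by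
  rw [B.equivocation_eq hδ]
  have hp : ∀ s, 0 ≤ slotLaw P δ (n * B.T) s := slotLaw_nonneg _
  have hp1 := sum_slotLaw (P := P) hδ (n * B.T)
  refine div_le_div_of_nonneg_right ?_ (Real.log_nonneg (by norm_num))
  set p := slotLaw P δ (n * B.T)
  let X : (Fin (n * B.T) → Bool) → (B.silentPeriods n → ℕ) :=
    fun s k => jobPattern B.T (extendFalse s) k
  let Q : (Fin (n * B.T) → Bool) → (B.silentEnds n → ℕ) :=
    fun s k => queue B.issue (extendFalse s) ((k + 1) * B.T)
  let V := B.loudArrivals n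
  let Z := B.observed n
  have h1 : ent p (fun s => (X s, Z s)) ≤ ent p (fun s => (B.counts n s, Z s)) := by
    refine ent_le_of_determines hp fun s s' h => ?_
    simp only [Prod.mk.injEq] at h ⊢
    refine ⟨funext fun k => ?_, h.2⟩
    exact congrFun h.1 ⟨k, Finset.mem_range.1 (Finset.mem_filter.1 k.2).1⟩
  -- Conditioning on `(V, Q)` in addition to `Z` does not increase the entropy of `X`.
  have h2 := ent_submodular hp X (fun s => (V s, Q s)) Z
  have h3 : ent p (fun s => ((V s, Q s), Z s)) ≤ ent p (fun s => (V s, Q s)) := by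
    refine ent_le_of_determines hp fun s s' h => ?_
    simp only [Prod.mk.injEq] at h ⊢
    refine ⟨h, ?_⟩
    refine (transcript_eq_iff B.infinite_isJobSlot B.T n _ _).2 fun t ht htJ => ?_
    refine queue_eq_of_eq_outside B.issue B.T_pos B.IsSilent ?_ ?_ ht (B.visible_of_isJobSlot htJ)
    · intro t ht hS
      rw [extendFalse_apply s ht, extendFalse_apply s' ht]
      have := congrFun h.1 ⟨t, ht⟩
      simpa [V, loudArrivals, hS] using this
    · intro k hk hk1 hk2
      exact congrFun h.2 ⟨k, Finset.mem_filter.2 ⟨Finset.mem_range.2 hk, hk1, hk2⟩⟩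
  have h4 := ent_prod_le hp hp1 V Q
  have h5 : ent p (fun s => (X s, V s)) ≤ ent p (fun s => (X s, (V s, Q s), Z s)) := by
    refine ent_le_of_determines hp fun s s' h => ?_
    simp only [Prod.mk.injEq] at h ⊢
    exact ⟨h.1, h.2.1.1⟩
  have h6 : ent p (fun s => (X s, V s)) = (B.silentPeriods n).card * countEntropy P δ B.T
      + ent p V := B.ent_silent_counts hδ hind hlaw n (Finset.Subset.refl _)
  have h7 : ent p Q ≤ (B.silentEnds n).card * Real.log ((n * B.T + 1 : ℕ) : ℝ) := by
    refine (ent_pi_le hp hp1 (fun k s => queue B.issue (extendFalse s) ((k + 1) * B.T))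
      (B.silentEnds n)).trans ?_
    rw [← nsmul_eq_mul]
    refine Finset.sum_le_card_nsmul _ _ _ fun k hk => ?_
    have hkn := Finset.mem_range.1 (Finset.mem_filter.1 hk).1
    have := ent_le_log_card hp hp1
      (fun s => queue B.issue (extendFalse s) ((k + 1) * B.T)) (Y := Finset.range (n * B.T + 1))
      fun s => Finset.mem_range.2 (Nat.lt_succ_of_le ((queue_le _ _ _).trans
        (Nat.mul_le_mul_right _ hkn)))
    rwa [Finset.card_range] at this
  change _ ≤ ent p (fun s => (B.counts n s, Z s)) - ent p Z
  linarith

/-- The equivocation rate of the schedule: only the job counts of the silent periods remain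
unknown. -/
lemma tendsto_equivocation {lam : ℝ} (hδ : ∀ j, Measurable (δ j)) (hind : iIndepFun δ P)
    (hlaw : ∀ j, P.real {ω | δ j ω = true} = lam)
    (hT : 1 ≤ (1 - lam) * B.T) (hD : 0 < B.surplus lam) :
    Tendsto (fun n : ℕ => equivocation P δ (fun k _ => B.issue k) B.T n / (n : ℝ)) atTop
      (𝓝 ((B.s : ℝ) / B.len * countEntropy P δ B.T / Real.log 2)) := by
  have hS := B.tendsto_silent.mul_const (countEntropy P δ B.T)
  have hcard : ∀ n, ((∑ k ∈ Finset.range n, (if B.IsSilent k then 1 else 0) : ℕ) : ℝ)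
      = (B.silentPeriods n).card := by
    intro n
    rw [silentPeriods, Finset.card_filter]
  simp only [hcard] at hS
  have lo := ((hS.sub B.tendsto_card_silentEnds_mul_log).div_const (Real.log 2))
  have hi := ((hS.add (B.tendsto_residueEntropy hδ hind hlaw hT hD).cesaro).div_const (Real.log 2))
  simp only [sub_zero, add_zero] at lo hi
  refine tendsto_of_tendsto_of_tendsto_of_le_of_le lo hi (fun n => ?_) (fun n => ?_)
  · refine le_trans (le_of_eq ?_)
      (div_le_div_of_nonneg_right (B.le_equivocation hδ hind hlaw n) (Nat.cast_nonneg n))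
    ring
  · refine (div_le_div_of_nonneg_right (B.equivocation_le hδ n) (Nat.cast_nonneg n)).trans
      (le_of_eq ?_)
    have : ∑ k ∈ Finset.range n, B.residueEntropy P δ k
        = (B.silentPeriods n).card * countEntropy P δ B.T
          + ∑ k ∈ Finset.range n, (if B.IsSilent k then 0 else B.residueEntropy P δ k) := by
      rw [← hcard, Nat.cast_sum, Finset.sum_mul, ← Finset.sum_add_distrib]
      refine Finset.sum_congr rfl fun k _ => ?_
      split_ifs with h
      · simp [B.residueEntropy_of_isSilent hδ hind hlaw h]
      · simp
    rw [this]
    ring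

end BlockPlan

end FCFS

/-! ### The infimum over attacks -/

namespace FCFS

section Attack

variable {Ω : Type*} [MeasurableSpace Ω] {P : Measure Ω} {δ : ℕ → Ω → Bool}

lemma condEntropy_nonneg [IsFiniteMeasure P] {α β : Type*} (X : Ω → α) (Y : Ω → β) :
    0 ≤ condEntropy P X Y := by
  refine tsum_nonneg fun y => tsum_nonneg fun x => neg_nonneg.2 ?_
  have h : P.real {ω | X ω = x ∧ Y ω = y} ≤ P.real {ω | Y ω = y} :=
    measureReal_mono fun ω hω => hω.2
  exact mul_nonpos_of_nonneg_of_nonpos measureReal_nonneg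
    (Real.logb_nonpos (by norm_num) (by positivity) (div_le_one_of_le₀ h measureReal_nonneg))

lemma zero_mem_lowerBounds_equivocationRates [IsFiniteMeasure P] (lam : ℝ) (T : ℕ)
    (C : Set (ℕ → Ω → ℕ)) : 0 ∈ lowerBounds (equivocationRates P δ lam T C) := by
  rintro L ⟨A, -, -, hL⟩
  exact ge_of_tendsto' hL fun n => div_nonneg (condEntropy_nonneg _ _) (Nat.cast_nonneg n)

namespace BlockPlan

variable (B : BlockPlan)

lemma isObliviousAttack (U : Ω → ℝ) : IsObliviousAttack U fun k (_ : Ω) => B.issue k where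
  strictMono _ := B.strictMono_issue
  measurable _ := measurable_const
  oblivious _ := measurable_const

lemma isCausalAttack (U : Ω → ℝ) (δ : ℕ → Ω → Bool) :
    IsCausalAttack U δ fun k (_ : Ω) => B.issue k where
  strictMono _ := B.strictMono_issue
  measurable _ := measurable_const
  causal _ _ := MeasurableSet.const _

lemma mem_equivocationRates {lam L : ℝ} {C : Set (ℕ → Ω → ℕ)}
    (hC : (fun k (_ : Ω) => B.issue k) ∈ C)
    (hrate : ((B.b * B.T + B.c : ℕ) : ℝ) / ((B.len * B.T : ℕ) : ℝ) < 1 - lam)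
    (hL : Tendsto (fun n : ℕ => equivocation P δ (fun k _ => B.issue k) B.T n / (n : ℝ)) atTop
      (𝓝 L)) : L ∈ equivocationRates P δ lam B.T C :=
  ⟨_, hC, ⟨_, hrate, ae_of_all _ fun _ => B.tendsto_rate⟩, hL⟩

/-- If the user issues no jobs, there is nothing to learn about him. -/
lemma equivocation_eq_zero [IsProbabilityMeasure P] (hδ : ∀ j, Measurable (δ j))
    (hlaw : ∀ j, P.real {ω | δ j ω = true} = 0) (n : ℕ) :
    equivocation P δ (fun k _ => B.issue k) B.T n = 0 := by
  refine le_antisymm ((B.equivocation_le hδ n).trans (le_of_eq ?_)) (condEntropy_nonneg _ _)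
  have hae : ∀ᵐ ω ∂P, (fun j => δ j ω) = fun _ => false := by
    have : ∀ᵐ ω ∂P, ∀ j, δ j ω = false := by
      refine ae_all_iff.2 fun j => ?_
      have h := hlaw j
      rw [measureReal_eq_zero_iff] at h
      rw [ae_iff]
      simpa using h
    filter_upwards [this] with ω hω using funext hω
  rw [Finset.sum_eq_zero, zero_div]
  intro k _
  refine Finset.sum_eq_zero fun y _ => ?_
  by_cases hy : B.residue k (fun _ => false) = y
  · have : P.real {ω | B.residue k (fun j => δ j ω) = y} = 1 := by
      rw [← probReal_univ (μ := P)]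
      refine measureReal_congr (Filter.eventuallyEq_set.2 ?_)
      filter_upwards [hae] with ω hω
      simp [hω, hy]
    rw [this, Real.negMulLog_one]
  · have : P.real {ω | B.residue k (fun j => δ j ω) = y} = 0 := by
      rw [← measureReal_empty (μ := P)]
      refine measureReal_congr (Filter.eventuallyEq_set.2 ?_)
      filter_upwards [hae] with ω hω
      simp [hω, hy]
    rw [this, Real.negMulLog_zero]

end BlockPlan

/-- Block schedules of admissible rate with a small share of silent periods. -/
lemma exists_blockPlan {lam : ℝ} (h0 : 0 < lam) (h1 : lam < 1) {T : ℕ} (hT0 : 0 < T)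
    (hT : 1 ≤ (1 - lam) * T) {η : ℝ} (hη : 0 < η) :
    ∃ B : BlockPlan, B.T = T ∧ 0 < B.surplus lam ∧
      ((B.b * B.T + B.c : ℕ) : ℝ) / ((B.len * B.T : ℕ) : ℝ) < 1 - lam ∧
      (B.s : ℝ) / B.len < η := by
  have hα : 0 < 1 - lam := by linarith
  have hTr : (0 : ℝ) < T := by exact_mod_cast hT0
  -- The rate condition is equivalent to `surplus < (1 - lam) * T * s`: the silence has the capacity
  -- to clear the surplus. As the surplus will be at most `lam * T`, this choice of `s` suffices for
  -- every `c`.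
  obtain ⟨s, hs⟩ := exists_nat_gt (lam / (1 - lam))
  have hs0 : (0 : ℝ) < s := (div_pos h0 hα).trans hs
  -- A long sampling phase makes the silent share small.
  obtain ⟨c, hc⟩ := exists_nat_gt ((s : ℝ) / η)
  have hc0 : (0 : ℝ) < c := (div_pos hs0 hη).trans hc
  -- The burst length at which the surplus vanishes; `b` is the least natural number above it.
  set x := c * ((1 - lam) * T - 1) / (T * lam) with hx
  have hx0 : 0 ≤ x := div_nonneg (mul_nonneg hc0.le (by linarith)) (by positivity)
  have hxm : x * (T * lam) = c * ((1 - lam) * T - 1) := div_mul_cancel₀ _ (by positivity)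
  have hb1 : x < (⌊x⌋₊ + 1 : ℕ) := by push_cast; exact Nat.lt_floor_add_one x
  have hb2 : ((⌊x⌋₊ + 1 : ℕ) : ℝ) ≤ x + 1 := by
    push_cast
    linarith [Nat.floor_le hx0]
  set b := ⌊x⌋₊ + 1
  refine ⟨⟨b, c, s, T, by exact_mod_cast hc0, by exact_mod_cast hs0, hT0⟩, rfl, ?_, ?_, ?_⟩
  · have := mul_lt_mul_of_pos_right hb1 (mul_pos hTr h0)
    simp only [BlockPlan.surplus]
    linarith
  · simp only [BlockPlan.len]
    push_cast
    rw [div_lt_iff₀ (by positivity)]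
    have e1 := mul_le_mul_of_nonneg_right hb2 (mul_pos hTr h0).le
    have e2 := mul_lt_mul_of_pos_right ((div_lt_iff₀ hα).1 hs) hTr
    linarith
  · simp only [BlockPlan.len]
    push_cast
    rw [div_lt_iff₀ (by positivity)]
    have e1 := (div_lt_iff₀ hη).1 hc
    have : 0 ≤ η * (b + s) := by positivity
    linarith

lemma countEntropy_nonneg [IsProbabilityMeasure P] (T : ℕ) :
    0 ≤ BlockPlan.countEntropy P δ T :=
  Finset.sum_nonneg fun _ _ => Real.negMulLog_nonneg measureReal_nonneg measureReal_le_one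

/-- Deterministic schedules achieve arbitrarily small equivocation rates. -/
lemma isGLB_equivocationRates [IsProbabilityMeasure P] {lam : ℝ} (hlam0 : 0 ≤ lam)
    (hlam1 : lam < 1) {T : ℕ} (hT : ⌈1 / (1 - lam)⌉₊ ≤ T) (hδ : ∀ j, Measurable (δ j))
    (hind : iIndepFun δ P) (hlaw : ∀ j, P.real {ω | δ j ω = true} = lam)
    {C : Set (ℕ → Ω → ℕ)} (hC : ∀ B : BlockPlan, (fun k (_ : Ω) => B.issue k) ∈ C) :
    IsGLB (equivocationRates P δ lam T C) 0 := by
  refine ⟨zero_mem_lowerBounds_equivocationRates lam T C, fun m hm => ?_⟩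
  have hα : 0 < 1 - lam := by linarith
  have hT1 : 1 ≤ (1 - lam) * T := by
    have := Nat.ceil_le.1 hT
    rw [div_le_iff₀ hα] at this
    linarith
  have hT0 : 0 < T := by
    rcases Nat.eq_zero_or_pos T with h | h
    · rw [h] at hT1; norm_num at hT1
    · exact h
  rcases hlam0.eq_or_lt with rfl | hpos
  -- For `lam = 0` the surplus is never positive, but any schedule of admissible rate serves; this
  -- one has rate `1 / (2 * T)`.
  · let B : BlockPlan := ⟨0, 1, 1, T, one_pos, one_pos, hT0⟩
    refine hm (B.mem_equivocationRates (hC B) ?_ ?_)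
    · have : (1 : ℝ) ≤ T := by exact_mod_cast hT0
      simp only [B, BlockPlan.len]
      push_cast
      rw [div_lt_iff₀ (by positivity)]
      linarith
    · simp [B.equivocation_eq_zero hδ hlaw]
  · refine le_of_forall_pos_le_add fun ε hε => ?_
    have hlog : 0 < Real.log 2 := Real.log_pos (by norm_num)
    have hH : 0 ≤ BlockPlan.countEntropy P δ T := countEntropy_nonneg T
    obtain ⟨B, rfl, hD, hrate, hs⟩ := exists_blockPlan hpos hlam1 hT0 hT1
      (η := ε * Real.log 2 / (BlockPlan.countEntropy P δ T + 1)) (by positivity)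
    refine (hm (B.mem_equivocationRates (hC B) hrate
      (B.tendsto_equivocation hδ hind hlaw hT1 hD))).trans ?_
    rw [zero_add, div_le_iff₀ hlog]
    calc (B.s : ℝ) / B.len * BlockPlan.countEntropy P δ B.T
        ≤ (B.s : ℝ) / B.len * (BlockPlan.countEntropy P δ B.T + 1) := by gcongr; linarith
      _ ≤ ε * Real.log 2 := by
        rw [lt_div_iff₀ (by positivity)] at hs
        exact hs.le

end Attack

end FCFS

theorem theorem1 {Ω : Type*} [MeasurableSpace Ω] (P : Measure Ω) [IsProbabilityMeasure P]
    (lam : ℝ) (hlam0 : 0 ≤ lam) (hlam1 : lam < 1)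
    (T : ℕ) (hT : ⌈1 / (1 - lam)⌉₊ ≤ T)
    (δ : ℕ → Ω → Bool) (hδ_meas : ∀ j, Measurable (δ j)) (hδ_indep : iIndepFun δ P)
    (hδ_law : ∀ j, P.real {ω | δ j ω = true} = lam)
    (U : Ω → ℝ) (hU_meas : Measurable U)
    (hU_law : P.map U = volume.restrict (Set.Icc (0 : ℝ) 1))
    (hU_indep : IndepFun U (fun ω j => δ j ω) P) :
    IsGLB (FCFS.equivocationRates P δ lam T {A | FCFS.IsCausalAttack U δ A}) 0 ∧
      IsGLB (FCFS.equivocationRates P δ lam T {A | FCFS.IsObliviousAttack U A}) 0 :=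
  ⟨FCFS.isGLB_equivocationRates hlam0 hlam1 hT hδ_meas hδ_indep hδ_law
      fun B => B.isCausalAttack U δ,
    FCFS.isGLB_equivocationRates hlam0 hlam1 hT hδ_meas hδ_indep hδ_law
      fun B => B.isObliviousAttack U⟩
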